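/- Let $a:\mathbb{Z}\to(-\infty,0)$ and $b:\mathbb{Z}\to\mathbb{R}$ be sequences with $a(n)\to-1$ and $b(n)\to0$ as $|n|\to\infty$, and let $W$ be the bounded self-adjoint Jacobi operator on $\ell^2(\mathbb{Z})$ given by $$(Wu)(n)=a(n-1)u(n-1)+a(n)u(n+1)+b(n)u(n),\qquad n\in\mathbb{Z}.$$ Let $(\lambda_j)_j$ be the (finite or infinite) family of distinct eigenvalues of $W$ outside $[-2,2]$, and write $\lambda_j=-k_j-\frac1{k_j}$ with the unique real $k_j$ satisfying $|k_j|>1$. (i) If $b\in\ell^2(\mathbb{Z})$ and $\sum_{n\in\mathbb{Z}}\big(a(n)^2-1-\log a(n)^2\big)<\infty$, then the sum on the left below converges and $$\sum_j\Big(k_j^2-\frac1{k_j^2}-\log|k_j|^4\Big)\le\sum_{n\in\mathbb{Z}}b(n)^2+2\sum_{n\in\mathbb{Z}}\big(a(n)^2-1-\log a(n)^2\big).$$ (ii) In particular, if $a(n)=-1$ for all $n$ and $b\in\ell^2(\mathbb{Z})$, then $$\sum_j\Big(k_j^2-\frac1{k_j^2}-\log|k_j|^4\Big)\le\sum_{n\in\mathbb{Z}}b(n)^2.$$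 (iii) The inequality in (i) is sharp: for every $\omega>0$, with $c_n=\cosh(\omega n)$, the Jacobi operator with $$a(n)=-\frac{\sqrt{c_nc_{n+2}}}{c_{n+1}},\qquad b(n)=\frac{c_n}{c_{n+1}}-\frac{c_{n-1}}{c_n}$$ satisfies the assumptions of (i), has $-2\cosh\omega$ as its only eigenvalue outside $[-2,2]$, and attains equality in (i). Moreover it is reflectionless: for every $z\in\mathbb{C}$ with $|z|=1$, $z\ne\pm1$, the difference equation $a(n-1)u(n-1)+a(n)u(n+1)+b(n)u(n)=-(z+z^{-1})u(n)$ has a solution $u:\mathbb{Z}\to\mathbb{C}$ with $u(n)-z^n\to0$ as $n\to-\infty$ and $u(n)-Tz^n\to0$ as $n\to+\infty$ for some $T\in\mathbb{C}$. -/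

import Mathlib

open Filter Topology

open scoped lp ENNReal

noncomputable section

/-- Coefficients of a scalar Jacobi operator on `ℓ²(ℤ)`: off-diagonal entries `a(n) < 0` with
`a(n) → -1` and a real potential with `b(n) → 0` as `|n| → ∞`
(on `ℤ`, `|n| → ∞` is the filter `cofinite`). Such `a` and `b` are bounded. -/
structure JacobiCoeffs where
  a : ℤ → ℝ
  b : ℤ → ℝ
  a_neg : ∀ n, a n < 0
  a_tendsto : Tendsto a cofinite (𝓝 (-1))
  b_tendsto : Tendsto b cofinite (𝓝 0)

namespace JacobiCoeffs

/-- The Jacobi difference expression on arbitrary complex sequences: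
`(Wu)(n) = a(n-1) u(n-1) + a(n) u(n+1) + b(n) u(n)`. -/
def diffExpr (J : JacobiCoeffs) (u : ℤ → ℂ) (n : ℤ) : ℂ :=
  (J.a (n - 1) : ℂ) * u (n - 1) + (J.a n : ℂ) * u (n + 1) + (J.b n : ℂ) * u n

theorem memℓp_mul_of_tendsto {f : ℤ → ℝ} {c : ℝ} (hf : Tendsto f cofinite (𝓝 c))
    {u : ℤ → ℂ} (hu : Memℓp u 2) : Memℓp (fun n => (f n : ℂ) * u n) 2 := by
  obtain ⟨K, hK⟩ := hf.norm.bddAbove_range_of_cofinite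
  refine ((hu.norm).const_mul K).mono fun n => ?_
  rw [norm_mul, Complex.norm_real]
  exact mul_le_mul_of_nonneg_right (hK ⟨n, rfl⟩) (norm_nonneg _)

theorem memℓp_comp_add (m : ℤ) {u : ℤ → ℂ} (hu : Memℓp u 2) :
    Memℓp (fun n => u (n + m)) 2 := by
  have h2 : 0 < (2 : ℝ≥0∞).toReal := by norm_num
  rw [memℓp_gen_iff h2] at hu ⊢
  exact hu.comp_injective (add_left_injective m)

theorem memℓp_a_mul_pred (J : JacobiCoeffs) {u : ℤ → ℂ} (hu : Memℓp u 2) :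
    Memℓp (fun n => (J.a (n - 1) : ℂ) * u (n - 1)) 2 := by
  have h := memℓp_comp_add (-1) (memℓp_mul_of_tendsto J.a_tendsto hu)
  simpa only [← sub_eq_add_neg] using h

theorem memℓp_a_mul_succ (J : JacobiCoeffs) {u : ℤ → ℂ} (hu : Memℓp u 2) :
    Memℓp (fun n => (J.a n : ℂ) * u (n + 1)) 2 :=
  memℓp_mul_of_tendsto J.a_tendsto (memℓp_comp_add 1 hu)

theorem memℓp_diffExpr (J : JacobiCoeffs) {u : ℤ → ℂ} (hu : Memℓp u 2) :
    Memℓp (J.diffExpr u) 2 :=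
  ((J.memℓp_a_mul_pred hu).add (J.memℓp_a_mul_succ hu)).add (memℓp_mul_of_tendsto J.b_tendsto hu)

/-- The Jacobi operator as a linear map on all of `ℓ²(ℤ, ℂ)`. -/
def linOp (J : JacobiCoeffs) : ℓ²(ℤ, ℂ) →ₗ[ℂ] ℓ²(ℤ, ℂ) where
  toFun u := ⟨J.diffExpr u, J.memℓp_diffExpr (lp.memℓp u)⟩
  map_add' u v := by
    ext n
    simp only [diffExpr, lp.coeFn_add, Pi.add_apply]
    ring
  map_smul' c u := by
    ext n
    simp only [diffExpr, lp.coeFn_smul, Pi.smul_apply, smul_eq_mul, RingHom.id_apply]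
    ring

theorem summable_mul_conj {x y : ℤ → ℂ} (hx : Memℓp x 2) (hy : Memℓp y 2) :
    Summable fun n => y n * (starRingEnd ℂ) (x n) := by
  simpa using lp.summable_inner (𝕜 := ℂ) (⟨x, hx⟩ : ℓ²(ℤ, ℂ)) (⟨y, hy⟩ : ℓ²(ℤ, ℂ))

theorem tsum_diffExpr_symm (J : JacobiCoeffs) {f g : ℤ → ℂ} (hf : Memℓp f 2) (hg : Memℓp g 2) :
    ∑' n, g n * (starRingEnd ℂ) (J.diffExpr f n) =
      ∑' n, J.diffExpr g n * (starRingEnd ℂ) (f n) := by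
  have s1 := summable_mul_conj (J.memℓp_a_mul_pred hf) hg
  have s2 := summable_mul_conj (J.memℓp_a_mul_succ hf) hg
  have s3 := summable_mul_conj (memℓp_mul_of_tendsto J.b_tendsto hf) hg
  have t1 := summable_mul_conj hf (J.memℓp_a_mul_pred hg)
  have t2 := summable_mul_conj hf (J.memℓp_a_mul_succ hg)
  have t3 := summable_mul_conj hf (memℓp_mul_of_tendsto J.b_tendsto hg)
  have e1 := (Equiv.addRight (1 : ℤ)).tsum_eq
    (fun n => g n * (starRingEnd ℂ) ((J.a (n - 1) : ℂ) * f (n - 1)))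
  have e2 := (Equiv.addRight (1 : ℤ)).tsum_eq
    (fun n => ((J.a (n - 1) : ℂ) * g (n - 1)) * (starRingEnd ℂ) (f n))
  simp only [Equiv.coe_addRight, add_sub_cancel_right] at e1 e2
  have hL : ∀ n, g n * (starRingEnd ℂ) (J.diffExpr f n) =
      g n * (starRingEnd ℂ) ((J.a (n - 1) : ℂ) * f (n - 1)) +
      g n * (starRingEnd ℂ) ((J.a n : ℂ) * f (n + 1)) +
      g n * (starRingEnd ℂ) ((J.b n : ℂ) * f n) := fun n => by
    rw [diffExpr, map_add, map_add, mul_add, mul_add]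
  have hR : ∀ n, J.diffExpr g n * (starRingEnd ℂ) (f n) =
      ((J.a (n - 1) : ℂ) * g (n - 1)) * (starRingEnd ℂ) (f n) +
      ((J.a n : ℂ) * g (n + 1)) * (starRingEnd ℂ) (f n) +
      ((J.b n : ℂ) * g n) * (starRingEnd ℂ) (f n) := fun n => by
    rw [diffExpr, add_mul, add_mul]
  have hc : ∀ (r : ℝ) (x y : ℂ),
      x * (starRingEnd ℂ) ((r : ℂ) * y) = ((r : ℂ) * x) * (starRingEnd ℂ) y := fun r x y => by
    rw [map_mul, Complex.conj_ofReal, mul_left_comm, mul_assoc]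
  rw [tsum_congr hL, tsum_congr hR, Summable.tsum_add (s1.add s2) s3, Summable.tsum_add s1 s2,
    Summable.tsum_add (t1.add t2) t3, Summable.tsum_add t1 t2, ← e1, ← e2,
    tsum_congr fun n => hc (J.a n) (g (n + 1)) (f n),
    tsum_congr fun n => hc (J.a n) (g n) (f (n + 1)),
    tsum_congr fun n => hc (J.b n) (g n) (f n),
    add_comm (∑' n, ((J.a n : ℂ) * g n) * (starRingEnd ℂ) (f (n + 1)))]

theorem linOp_isSymmetric (J : JacobiCoeffs) : J.linOp.IsSymmetric := by
  intro u v
  rw [lp.inner_eq_tsum, lp.inner_eq_tsum]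
  exact J.tsum_diffExpr_symm (lp.memℓp u) (lp.memℓp v)

/-- The bounded Jacobi operator `W` on `ℓ²(ℤ, ℂ)`
(a symmetric operator defined on the whole Hilbert space is bounded and self-adjoint). -/
def op (J : JacobiCoeffs) : ℓ²(ℤ, ℂ) →L[ℂ] ℓ²(ℤ, ℂ) :=
  J.linOp_isSymmetric.toSelfAdjoint

theorem op_apply (J : JacobiCoeffs) (u : ℓ²(ℤ, ℂ)) (n : ℤ) :
    J.op u n = (J.a (n - 1) : ℂ) * u (n - 1) + (J.a n : ℂ) * u (n + 1) + (J.b n : ℂ) * u n :=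
  rfl

theorem op_isSelfAdjoint (J : JacobiCoeffs) : IsSelfAdjoint J.op :=
  J.linOp_isSymmetric.toSelfAdjoint.2

/-- The eigenvalues of `W` outside `[-2, 2]`. They are real because `W` is self-adjoint. -/
def outerEigenvalues (J : JacobiCoeffs) : Set ℝ :=
  {lam : ℝ | lam ∉ Set.Icc (-2 : ℝ) 2 ∧
    Module.End.HasEigenvalue (J.op : Module.End ℂ ℓ²(ℤ, ℂ)) (lam : ℂ)}

/-- `W` is reflectionless: for every `z = e^{iθ} ≠ ±1` on the unit circle, the wave `zⁿ` coming in
from `-∞` is transmitted without a reflected wave. That is, the equation `Wu = -(z + 1/z)u` has a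
solution asymptotic to `zⁿ` at `-∞` and to a multiple `T zⁿ` at `+∞`. -/
def IsReflectionless (J : JacobiCoeffs) : Prop :=
  ∀ z : ℂ, ‖z‖ = 1 → z ≠ 1 → z ≠ -1 →
    ∃ (u : ℤ → ℂ) (T : ℂ), (∀ n, J.diffExpr u n = -(z + z⁻¹) * u n) ∧
      Tendsto (fun n : ℤ => u n - z ^ n) atBot (𝓝 0) ∧
      Tendsto (fun n : ℤ => u n - T * z ^ n) atTop (𝓝 0)

end JacobiCoeffs

/-- For real `lam` with `|lam| > 2`, the unique real number `k` with `|k| > 1` and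
`lam = -k - 1/k`. -/
def eigenParam (lam : ℝ) : ℝ :=
  (-lam - (SignType.sign lam : ℝ) * √(lam ^ 2 - 4)) / 2

theorem eigenParam_unique {lam k : ℝ} (hk : 1 < |k|) (h : lam = -k - 1 / k) :
    k = eigenParam lam := by
  have hk0 : k ≠ 0 := by
    rintro rfl
    simp at hk
    linarith
  have hsq : lam ^ 2 - 4 = (k - 1 / k) ^ 2 := by
    rw [h]
    field_simp
    ring
  unfold eigenParam
  rw [hsq, Real.sqrt_sq_eq_abs]
  rcases lt_or_gt_of_ne hk0 with hneg | hpos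
  · rw [abs_of_neg hneg] at hk
    have h1 : 1 / k < 0 := one_div_neg.2 hneg
    have h2 : -1 < 1 / k := by
      rw [lt_div_iff_of_neg hneg]
      linarith
    rw [sign_pos (by linarith), abs_of_neg (by linarith), h]
    simp only [SignType.coe_one]
    ring
  · rw [abs_of_pos hpos] at hk
    have h1 : 0 < 1 / k := one_div_pos.2 hpos
    have h2 : 1 / k < 1 := (div_lt_one hpos).2 hk
    rw [sign_neg (by linarith), abs_of_pos (by linarith), h]
    simp only [SignType.coe_neg_one]
    ring

theorem eigenParam_spec {lam : ℝ} (h : lam ∉ Set.Icc (-2 : ℝ) 2) :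
    1 < |eigenParam lam| ∧ lam = -eigenParam lam - 1 / eigenParam lam := by
  rw [Set.mem_Icc, not_and_or, not_le, not_le] at h
  have hs : √(lam ^ 2 - 4) ^ 2 = lam ^ 2 - 4 := by
    refine Real.sq_sqrt ?_
    rcases h with h | h <;> nlinarith
  have hnn := Real.sqrt_nonneg (lam ^ 2 - 4)
  have hquad : eigenParam lam ^ 2 + lam * eigenParam lam + 1 = 0 ∧ 1 < |eigenParam lam| := by
    unfold eigenParam
    rcases h with h | h
    · rw [sign_neg (by linarith), abs_of_pos] <;> simp only [SignType.coe_neg_one]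
      · exact ⟨by nlinarith, by linarith⟩
      · linarith
    · rw [sign_pos (by linarith), abs_of_neg] <;> simp only [SignType.coe_one]
      · exact ⟨by nlinarith, by linarith⟩
      · linarith
  refine ⟨hquad.2, ?_⟩
  have h0 : eigenParam lam ≠ 0 := by
    intro h0
    have := hquad.1
    rw [h0] at this
    norm_num at this
  rw [eq_sub_iff_add_eq, ← mul_left_inj' h0, add_mul, one_div, inv_mul_cancel₀ h0]
  linarith [hquad.1]

/-- The contribution `k² - k⁻² - log |k|⁴` of an eigenvalue `lam = -k - 1/k`, `|k| > 1`. -/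
def eigenTerm (lam : ℝ) : ℝ :=
  eigenParam lam ^ 2 - 1 / eigenParam lam ^ 2 - Real.log (|eigenParam lam| ^ 4)

end

/-! The proof removes eigenvalues one at a time by double commutation. Let `p` be a real `ℓ²`
eigenvector for an eigenvalue `lam` outside `[-2, 2]`, and let `c n = ∑_{m > n} p(m)²`. Replacing `a
n` by `a n * √(c (n-1) * c (n+1)) / c n`, and correcting `b` by the difference of the current `a n *
p n * p (n+1) / c n`, gives another Jacobi operator of the same class. Three facts about it carry
the theorem.

Exact cost (`cost_eq`): the site costs `b² + 2(a² - 1 - log a²)` of the two operators differ by a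
telescoping term. Its potential tends to 0 at `-∞` and to `eigenTerm lam` at `+∞`, so the total cost
drops by exactly `eigenTerm lam`. The limits rest on the decay `p (n+1) / p n → k⁻¹`, hence `p² / c
→ k² - 1`.

Survival (`exists_isRealEigenvector_removeEigenvalue`): every other eigenvalue with a real
eigenvector remains one.

Positivity: `log x ≤ x - 1` makes each site cost nonnegative, so after removing any finite set of
outer eigenvalues the remaining cost is still at least 0. This bounds all finite sums
(`sum_eigenTerm_le`), which gives both convergence and the inequality.

For the soliton, one removal leaves cost zero, so its cost is a single `eigenTerm`. A second outer
eigenvalue would exceed this budget because `eigenTerm` is positive. Reflectionlessness comes from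
an explicit Jost solution. -/

/-! ### Asymptotics of decaying solutions -/

theorem tendsto_intAdd_natCast (n : ℤ) : Tendsto (fun m : ℕ => n + (m : ℤ)) atTop atTop :=
  tendsto_atTop_add_const_left _ _ tendsto_natCast_atTop_atTop

theorem nonneg_of_eventually_decreasing {v : ℤ → ℝ} (hv : Tendsto v atTop (𝓝 0))
    (h : ∀ᶠ n in atTop, v (n + 1) ≤ v n) : ∀ᶠ n in atTop, 0 ≤ v n := by
  obtain ⟨N, hN⟩ := eventually_atTop.1 h
  filter_upwards [eventually_ge_atTop N] with n hn
  have hanti : Antitone fun m : ℕ => v (n + m) := by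
    refine antitone_nat_of_succ_le fun m => ?_
    have := hN (n + m) (by omega)
    rwa [Nat.cast_succ, ← add_assoc]
  simpa using hanti.le_of_tendsto (hv.comp (tendsto_intAdd_natCast n)) 0

/-- In a perturbed hyperbolic linear recursion, if the expanding component tends to zero then it is
negligible with respect to the contracting component. -/
theorem eventually_expanding_lt_contracting {x y e : ℤ → ℝ} {k δ : ℝ} (hk : 1 < |k|) (hδ : 0 < δ)
    (hx : ∀ n, x (n + 1) = k * x n + e n) (hy : ∀ n, y (n + 1) = k⁻¹ * y n + e n)
    (he : ∀ ε > 0, ∀ᶠ n in atTop, |e n| ≤ ε * (|x n| + |y n|))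
    (hx0 : Tendsto x atTop (𝓝 0)) (hne : ∀ n, x n ≠ 0 ∨ y n ≠ 0) :
    ∀ᶠ n in atTop, |x n| < δ * |y n| := by
  -- Chosen so that `|k| - η ≥ (1 + |k|) / 2` and `|k| - η ≥ 1 + δ * η`: a defect of size `η * |x
  -- n|` spoils neither the growth of `x` nor the invariance of the cone `δ * |y| ≤ |x|`.
  set η : ℝ := (|k| - 1) / (2 * (1 + δ)) with hη
  have hη0 : 0 < η := div_pos (by linarith) (by linarith)
  have hη1 : η * (1 + δ) = (|k| - 1) / 2 := by
    rw [hη]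
    field_simp
  obtain ⟨N, hN⟩ := eventually_atTop.1 (he (η * δ / (1 + δ)) (by positivity))
  have hkinv : |k⁻¹| ≤ 1 := by
    rw [abs_inv]
    exact inv_le_one_of_one_le₀ hk.le
  have hstep : ∀ n ≥ N, δ * |y n| ≤ |x n| →
      (1 + |k|) / 2 * |x n| ≤ |x (n + 1)| ∧ δ * |y (n + 1)| ≤ |x (n + 1)| := by
    intro n hn hc
    have h1 : |e n| ≤ η * |x n| := by
      refine (hN n hn).trans ?_
      rw [div_mul_eq_mul_div, div_le_iff₀ (by linarith)]
      nlinarith [mul_le_mul_of_nonneg_left hc hη0.le]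
    have h2 : |k| * |x n| - |e n| ≤ |x (n + 1)| := by
      rw [hx, ← abs_mul]
      have := abs_sub_abs_le_abs_sub (k * x n) (-e n)
      rwa [abs_neg, sub_neg_eq_add] at this
    have h3 : |y (n + 1)| ≤ |y n| + |e n| := by
      rw [hy]
      refine (abs_add_le _ _).trans ?_
      rw [abs_mul]
      nlinarith [abs_nonneg (y n)]
    have hxn := abs_nonneg (x n)
    have hηδ : η * δ + η = (|k| - 1) / 2 := by linarith
    have h4 : η * |x n| + η * |x n| * δ = (|k| - 1) / 2 * |x n| := by rw [← hηδ]; ring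
    have h5 : 0 ≤ η * |x n| * δ := by positivity
    have h6 : δ * |y (n + 1)| ≤ δ * |y n| + δ * |e n| := by nlinarith
    have h7 : δ * |e n| ≤ η * |x n| * δ := by nlinarith
    have h8 : 0 ≤ (|k| - 1) * |x n| := mul_nonneg (by linarith) hxn
    constructor <;> nlinarith
  -- Once inside the cone the orbit stays there, so `|x|` grows geometrically, against `x → 0`.
  filter_upwards [eventually_ge_atTop N] with n hn
  by_contra! hc
  have hxn : x n ≠ 0 := by
    intro h0
    rcases hne n with h | h
    · exact h h0
    · rw [h0, abs_zero] at hc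
      exact absurd hc (not_le.2 (mul_pos hδ (abs_pos.2 h)))
  have hcone : ∀ m : ℕ, δ * |y (n + m)| ≤ |x (n + m)| := by
    intro m
    induction m with
    | zero => simpa using hc
    | succ m ih =>
      have := (hstep (n + m) (by omega) ih).2
      rwa [add_assoc] at this
  have hgrow : Tendsto (fun m : ℕ => |x (n + m)|) atTop atTop := by
    refine tendsto_atTop_of_geom_le (c := (1 + |k|) / 2) (by simpa using hxn) (by linarith) ?_
    intro m
    have := (hstep (n + m) (by omega) (hcone m)).1
    rwa [add_assoc] at this
  have hlim := (hx0.abs).comp (tendsto_intAdd_natCast n)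
  exact not_tendsto_atTop_of_tendsto_nhds hlim hgrow

/-- A decaying solution of an asymptotically free Jacobi recursion decays at the free rate. -/
theorem ratio_tendsto_of_decaying {a b p : ℤ → ℝ} {k : ℝ} (hk : 1 < |k|)
    (ha : Tendsto a atTop (𝓝 (-1))) (hb : Tendsto b atTop (𝓝 0)) (hp : Tendsto p atTop (𝓝 0))
    (hne : ∀ n, p n ≠ 0 ∨ p (n + 1) ≠ 0)
    (hrec : ∀ n, a (n - 1) * p (n - 1) + a n * p (n + 1) + b n * p n = (-k - 1 / k) * p n) :
    (∀ᶠ n in atTop, p n ≠ 0) ∧ Tendsto (fun n => p (n + 1) / p n) atTop (𝓝 k⁻¹) := by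
  have hk0 : k ≠ 0 := by
    rintro rfl
    simp at hk
    linarith
  have hkinv : |k⁻¹| ≤ 1 := by
    rw [abs_inv]
    exact inv_le_one_of_one_le₀ hk.le
  set D : ℝ := |k⁻¹ - k| with hD
  have hD0 : 0 < D := by
    have := abs_sub_abs_le_abs_sub k k⁻¹
    rw [abs_sub_comm] at this
    have h1 : |k⁻¹| < 1 := by
      rw [abs_inv]
      exact inv_lt_one_of_one_lt₀ hk
    linarith
  -- The free recursion has solutions `kⁿ` and `k⁻ⁿ`. The combination `x` kills `k⁻ⁿ` and expands by
  -- `k`, `y` kills `kⁿ` and contracts by `k⁻¹`, and `e` is the defect of `p` from the free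
  -- recursion.
  set x : ℤ → ℝ := fun n => p (n + 1) - k⁻¹ * p n with hx
  set y : ℤ → ℝ := fun n => p (n + 1) - k * p n with hy
  set e : ℤ → ℝ := fun n => p (n + 2) - (k + k⁻¹) * p (n + 1) + p n with he
  have hp1 : Tendsto (fun n : ℤ => p (n + 1)) atTop (𝓝 0) :=
    hp.comp (tendsto_atTop_add_const_right _ _ tendsto_id)
  have hDp : ∀ n, D * |p n| ≤ |x n| + |y n| := by
    intro n
    have : (k⁻¹ - k) * p n = y n - x n := by simp only [hx, hy]; ring
    rw [hD, ← abs_mul, this]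
    have := abs_sub (y n) (x n)
    linarith
  have hyD : ∀ n, |y n| ≤ D * |p n| + |x n| := by
    intro n
    have : y n = (k⁻¹ - k) * p n + x n := by simp only [hx, hy]; ring
    rw [this, hD, ← abs_mul]
    exact abs_add_le _ _
  have hsmall : ∀ δ > 0, ∀ᶠ n in atTop, |x n| < δ * |y n| := by
    intro δ hδ
    refine eventually_expanding_lt_contracting (e := e) hk hδ ?_ ?_ ?_ ?_ ?_
    · intro n
      simp only [hx, he, add_assoc, one_add_one_eq_two]
      field_simp
      ring
    · intro n
      simp only [hy, he, add_assoc, one_add_one_eq_two]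
      field_simp
      ring
    · intro ε hε
      set M : ℝ := 1 + 1 / D with hM
      have hM0 : 0 < M := by positivity
      set θ : ℝ := min (1 / 2) (ε / (2 * ((|k| + 4) * M))) with hθ
      have hθ0 : 0 < θ := by
        have : 0 < |k| + 4 := by positivity
        positivity
      have hθ1 : θ ≤ 1 / 2 := min_le_left _ _
      have hθ2 : θ * (2 * ((|k| + 4) * M)) ≤ ε := by
        rw [← le_div_iff₀ (by positivity)]
        exact min_le_right _ _
      have ea : ∀ᶠ n in atTop, |1 + a n| ≤ θ := by
        have := (ha.const_add 1).abs
        norm_num at this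
        exact (this.eventually (gt_mem_nhds hθ0)).mono fun _ h => h.le
      have eb : ∀ᶠ n in atTop, |b n| ≤ θ := by
        have := hb.abs
        norm_num at this
        exact (this.eventually (gt_mem_nhds hθ0)).mono fun _ h => h.le
      have sh : Tendsto (fun n : ℤ => n + 1) atTop atTop :=
        tendsto_atTop_add_const_right _ _ tendsto_id
      filter_upwards [ea, sh.eventually ea, sh.eventually eb] with n h1 h2 h3
      set S := |x n| + |y n| with hS
      have hS0 : 0 ≤ S := by positivity
      have q0' : |p n| ≤ S / D := by
        rw [le_div_iff₀ hD0, mul_comm]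
        exact hDp n
      have q0 : |p n| ≤ M * S := by
        refine q0'.trans ?_
        rw [hM, add_mul, one_div, inv_mul_eq_div]
        linarith
      have q1 : |p (n + 1)| ≤ M * S := by
        have : p (n + 1) = x n + k⁻¹ * p n := by simp only [hx]; ring
        rw [this]
        refine (abs_add_le _ _).trans ?_
        rw [abs_mul, hM, add_mul, one_div, inv_mul_eq_div]
        nlinarith [abs_nonneg (p n), abs_nonneg (y n)]
      have q2 : |p (n + 2)| ≤ |e n| + (|k| + 2) * (M * S) := by
        have : p (n + 2) = e n + (k + k⁻¹) * p (n + 1) + -p n := by simp only [he]; ring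
        rw [this]
        refine (abs_add_three _ _ _).trans ?_
        rw [abs_mul, abs_neg]
        have : |k + k⁻¹| ≤ |k| + 1 := (abs_add_le _ _).trans (by linarith)
        have := mul_le_mul this q1 (abs_nonneg _) (by positivity)
        linarith
      have key : e n = (1 + a (n + 1)) * p (n + 2) + (1 + a n) * p n + b (n + 1) * p (n + 1) := by
        have := hrec (n + 1)
        simp only [add_sub_cancel_right, add_assoc, one_add_one_eq_two, one_div] at this
        simp only [he]
        linear_combination -this
      have hb1 : |e n| ≤ θ * |p (n + 2)| + θ * |p n| + θ * |p (n + 1)| := by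
        conv_lhs => rw [key]
        refine (abs_add_three _ _ _).trans ?_
        rw [abs_mul, abs_mul, abs_mul]
        gcongr
      have hMS : 0 ≤ M * S := by positivity
      -- The bound on `p (n + 2)` itself involves `e n`; since `θ ≤ 1 / 2`, this term is absorbed on
      -- the left.
      have hb2 : |e n| ≤ θ * |e n| + θ * ((|k| + 4) * (M * S)) := by
        nlinarith [mul_le_mul_of_nonneg_left q0 hθ0.le, mul_le_mul_of_nonneg_left q1 hθ0.le,
          mul_le_mul_of_nonneg_left q2 hθ0.le]
      have hb3 : |e n| ≤ 2 * (θ * ((|k| + 4) * (M * S))) := by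
        nlinarith [mul_le_mul_of_nonneg_right hθ1 (abs_nonneg (e n))]
      calc |e n| ≤ 2 * (θ * ((|k| + 4) * (M * S))) := hb3
        _ = θ * (2 * ((|k| + 4) * M)) * S := by ring
        _ ≤ ε * S := mul_le_mul_of_nonneg_right hθ2 hS0
    · simpa using hp1.sub (hp.const_mul k⁻¹)
    · intro n
      by_contra! h
      have h1 := hDp n
      rw [h.1, h.2, abs_zero, add_zero] at h1
      have h2 : p n = 0 := by
        by_contra hpn
        exact absurd h1 (not_le.2 (mul_pos hD0 (abs_pos.2 hpn)))
      have h3 : p (n + 1) = 0 := by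
        have := h.1
        simpa [hx, h2] using this
      exact (hne n).elim (· h2) (· h3)
  have hbd : ∀ δ > 0, δ ≤ 1 / 2 → ∀ᶠ n in atTop, |x n| < 2 * δ * D * |p n| := by
    intro δ hδ hδ'
    filter_upwards [hsmall δ hδ] with n hn
    have h1 : |y n| ≤ 2 * D * |p n| := by
      nlinarith [hyD n, abs_nonneg (y n)]
    nlinarith
  have hpne : ∀ᶠ n in atTop, p n ≠ 0 := by
    filter_upwards [hbd (1 / 2) (by norm_num) le_rfl] with n hn h0
    rw [h0, abs_zero, mul_zero] at hn
    exact absurd hn (not_lt.2 (abs_nonneg _))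
  refine ⟨hpne, ?_⟩
  rw [Metric.tendsto_nhds]
  intro ε hε
  have hδ : 0 < min (1 / 2) (ε / (2 * D)) := by positivity
  filter_upwards [hpne, hbd _ hδ (min_le_left _ _)] with n h0 hn
  have h1 : p (n + 1) / p n - k⁻¹ = x n / p n := by
    simp only [hx]
    field_simp
  rw [Real.dist_eq, h1, abs_div, div_lt_iff₀ (abs_pos.2 h0)]
  refine hn.trans_le (mul_le_mul_of_nonneg_right ?_ (abs_nonneg _))
  have := min_le_right (1 / 2) (ε / (2 * D))
  rw [le_div_iff₀ (by positivity)] at this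
  linarith

/-- If `c` is the tail sum of `p²` and `p (n+1) / p n → k⁻¹`, then `p² / c → k² - 1`. -/
theorem sq_div_tail_tendsto {p c : ℤ → ℝ} {k : ℝ} (hk0 : k ≠ 0) (hc0 : ∀ n, 0 < c n)
    (hc : ∀ n, c n = c (n + 1) + p (n + 1) ^ 2) (hct : Tendsto c atTop (𝓝 0))
    (hp : Tendsto p atTop (𝓝 0)) (hpne : ∀ᶠ n in atTop, p n ≠ 0)
    (hr : Tendsto (fun n => p (n + 1) / p n) atTop (𝓝 k⁻¹)) :
    Tendsto (fun n => p n ^ 2 / c n) atTop (𝓝 (k ^ 2 - 1)) := by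
  have hk2 : 0 < k ^ 2 := by positivity
  have hlim : ∀ l : ℝ, Tendsto (fun n => (1 + l) * (p (n + 1) / p n) ^ 2) atTop
      (𝓝 ((1 + l) * k⁻¹ ^ 2)) := fun l => (hr.pow 2).const_mul _
  have hv : ∀ l : ℝ, Tendsto (fun n => p n ^ 2 - l * c n) atTop (𝓝 0) := fun l => by
    simpa using (hp.pow 2).sub (hct.const_mul l)
  rw [tendsto_order]
  -- For `l'` on either side of `k² - 1`, the sequence `p² - l' * c` is eventually monotone, since
  -- `p (n+1)² - l' * c (n+1) ≤ p n² - l' * c n` amounts to `(1 + l') * p (n+1)² ≤ p n²`. As it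
  -- tends to 0, its sign is determined.
  constructor
  · intro l hl
    obtain ⟨l', hl1, hl2⟩ := exists_between hl
    have h1 : (1 + l') * k⁻¹ ^ 2 < 1 := by
      rw [inv_pow, mul_inv_lt_iff₀ hk2]
      linarith
    have h2 : ∀ᶠ n in atTop, 0 ≤ p n ^ 2 - l' * c n := by
      refine nonneg_of_eventually_decreasing (hv l') ?_
      filter_upwards [hpne, (hlim l').eventually (gt_mem_nhds h1)] with n h0 h3
      rw [div_pow, ← mul_div_assoc, div_lt_one (by positivity)] at h3
      rw [hc n]
      linarith
    filter_upwards [h2] with n hn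
    rw [lt_div_iff₀ (hc0 n)]
    nlinarith [hc0 n]
  · intro l hl
    obtain ⟨l', hl1, hl2⟩ := exists_between hl
    have h1 : 1 < (1 + l') * k⁻¹ ^ 2 := by
      rw [inv_pow, lt_mul_inv_iff₀ hk2]
      linarith
    have h2 : ∀ᶠ n in atTop, 0 ≤ -(p n ^ 2 - l' * c n) := by
      refine nonneg_of_eventually_decreasing (by simpa using (hv l').neg) ?_
      filter_upwards [hpne, (hlim l').eventually (lt_mem_nhds h1)] with n h0 h3
      rw [div_pow, ← mul_div_assoc, one_lt_div (by positivity)] at h3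
      rw [hc n]
      linarith
    filter_upwards [h2] with n hn
    rw [div_lt_iff₀ (hc0 n)]
    nlinarith [hc0 n]

/-! ### Telescoping sums and tail sums -/

/-- Summation over `ℤ` of a nonnegative family that differs from a summable one by a
telescoping term. -/
theorem hasSum_int_of_telescoping {f h K : ℤ → ℝ} {T A B : ℝ} (hf : ∀ n, 0 ≤ f n)
    (hh : HasSum h T) (hK : ∀ n, f n = h n + (K n - K (n - 1)))
    (hA : Tendsto K atTop (𝓝 A)) (hB : Tendsto K atBot (𝓝 B)) : HasSum f (T + (A - B)) := by
  have htel : ∀ N : ℕ, ∑ n ∈ Finset.Ico (-N : ℤ) N, (K n - K (n - 1)) =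
      K (N - 1) - K (-N - 1) := by
    intro N
    induction N with
    | zero => simp
    | succ N ih =>
      have : Finset.Ico (-(N + 1 : ℕ) : ℤ) (N + 1 : ℕ) =
          insert (-(N : ℤ) - 1) (insert (N : ℤ) (Finset.Ico (-N : ℤ) N)) := by
        ext i
        simp only [Finset.mem_Ico, Finset.mem_insert]
        push_cast
        omega
      rw [this, Finset.sum_insert, Finset.sum_insert, ih]
      · push_cast
        rw [add_sub_cancel_right, neg_add', sub_sub]
        ring_nf
      · simp
      · simp only [Finset.mem_insert, Finset.mem_Ico]
        omega
  have hKA : Tendsto (fun N : ℕ => K ((N : ℤ) - 1)) atTop (𝓝 A) :=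
    hA.comp (tendsto_atTop_add_const_right _ (-1) tendsto_natCast_atTop_atTop)
  have hKB : Tendsto (fun N : ℕ => K (-(N : ℤ) - 1)) atTop (𝓝 B) :=
    hB.comp (tendsto_atBot_add_const_right _ (-1)
      (tendsto_neg_atTop_atBot.comp tendsto_natCast_atTop_atTop))
  have hlim : ∀ {F : ℤ → ℝ} {S : ℝ}, HasSum F S →
      Tendsto (fun N : ℕ => ∑ n ∈ Finset.Ico (-N : ℤ) N, F n) atTop (𝓝 S) := by
    intro F S hF
    have : Tendsto (fun s : Finset ℤ => ∑ n ∈ s, F n) atTop (𝓝 S) := by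
      simpa [HasSum] using hF
    exact this.comp Finset.tendsto_Ico_neg
  have hpart : Tendsto (fun N : ℕ => ∑ n ∈ Finset.Ico (-N : ℤ) N, f n) atTop
      (𝓝 (T + (A - B))) := by
    refine ((hlim hh).add (hKA.sub hKB)).congr fun N => ?_
    rw [← htel, ← Finset.sum_add_distrib]
    exact Finset.sum_congr rfl fun n _ => (hK n).symm
  have hmono : Monotone fun N : ℕ => ∑ n ∈ Finset.Ico (-N : ℤ) N, f n := by
    intro N M hNM
    refine Finset.sum_le_sum_of_subset_of_nonneg (Finset.Ico_subset_Ico (by omega) (by omega))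
      fun n _ _ => hf n
  -- Nonnegativity upgrades convergence of the symmetric partial sums to unconditional summability.
  have hsum : Summable f := by
    refine summable_of_sum_le (c := T + (A - B)) hf fun s => ?_
    obtain ⟨N, hN⟩ := (Finset.tendsto_Ico_neg (R := ℤ).eventually_ge_atTop s).exists
    exact (Finset.sum_le_sum_of_subset_of_nonneg hN fun n _ _ => hf n).trans
      (hmono.ge_of_tendsto hpart N)
  have := tendsto_nhds_unique (hlim hsum.hasSum) hpart
  rw [← this]
  exact hsum.hasSum

theorem tendsto_int_add_one_atTop : Tendsto (fun n : ℤ => n + 1) atTop atTop :=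
  tendsto_atTop_add_const_right _ 1 tendsto_id

theorem tendsto_int_add_one_atBot : Tendsto (fun n : ℤ => n + 1) atBot atBot :=
  tendsto_atBot_add_const_right _ 1 tendsto_id

theorem tendsto_int_sub_one_atTop : Tendsto (fun n : ℤ => n - 1) atTop atTop :=
  tendsto_atTop_add_const_right _ (-1) tendsto_id

theorem tendsto_int_sub_one_atBot : Tendsto (fun n : ℤ => n - 1) atBot atBot :=
  tendsto_atBot_add_const_right _ (-1) tendsto_id

theorem eq_of_sub_one_invariant {f : ℤ → ℝ} (h : ∀ n, f (n - 1) = f n) {l : Filter ℤ} [l.NeBot]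
    {L : ℝ} (hl : Tendsto f l (𝓝 L)) (n : ℤ) : f n = L := by
  have h0 : ∀ m, f m = f 0 := by
    intro m
    induction m using Int.induction_on with
    | zero => rfl
    | succ k ih => rw [← ih, ← h (k + 1), add_sub_cancel_right]
    | pred k ih => rw [h, ih]
  exact tendsto_nhds_unique (tendsto_const_nhds.congr fun m => (h0 n).trans (h0 m).symm) hl

/-- The tail `∑_{m > n} p(m)²`. -/
noncomputable def tailSq (p : ℤ → ℝ) (n : ℤ) : ℝ := ∑' m : ℤ, if n < m then p m ^ 2 else 0

section tailSq

variable {p : ℤ → ℝ}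

theorem summable_tail (hp : Summable fun n => p n ^ 2) (n : ℤ) : Summable fun m : ℤ => if n < m then p m ^ 2 else 0 := by
  refine hp.of_nonneg_of_le (fun m => ?_) fun m => ?_ <;> split_ifs <;> simp [sq_nonneg]

theorem tailSq_sub_one (hp : Summable fun n => p n ^ 2) (n : ℤ) :
    tailSq p (n - 1) = tailSq p n + p n ^ 2 := by
  rw [tailSq, tailSq, ← tsum_ite_eq n (fun m => p m ^ 2), ← (summable_tail hp n).tsum_add]
  · refine tsum_congr fun m => ?_
    rcases lt_trichotomy n m with h | h | h
    · rw [if_pos (by omega), if_pos h, if_neg (by omega), add_zero]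
    · rw [if_pos (by omega), if_neg (by omega), if_pos h.symm, zero_add]
    · rw [if_neg (by omega), if_neg (by omega), if_neg (by omega), add_zero]
  · exact summable_of_hasFiniteSupport ((Set.finite_singleton n).subset fun m hm => by
      by_contra h
      exact hm (if_neg h))

theorem tendsto_tailSq_atTop (hp : Summable fun n => p n ^ 2) :
    Tendsto (tailSq p) atTop (𝓝 0) := by
  have := tendsto_tsum_of_dominated_convergence (𝓕 := atTop)
    (f := fun n m : ℤ => if n < m then p m ^ 2 else 0) (g := fun _ => 0) hp
    (fun m => tendsto_const_nhds.congr' (by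
      filter_upwards [eventually_ge_atTop m] with n hn
      rw [if_neg (by omega)]))
    (Eventually.of_forall fun n m => by
      split_ifs <;> simp [sq_nonneg])
  rw [tsum_zero] at this
  exact this

theorem tendsto_tailSq_atBot (hp : Summable fun n => p n ^ 2) :
    Tendsto (tailSq p) atBot (𝓝 (∑' n, p n ^ 2)) :=
  tendsto_tsum_of_dominated_convergence (𝓕 := atBot)
    (f := fun n m : ℤ => if n < m then p m ^ 2 else 0) hp
    (fun m => tendsto_const_nhds.congr' (by
      filter_upwards [eventually_lt_atBot m] with n hn
      rw [if_pos hn]))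
    (Eventually.of_forall fun n m => by
      split_ifs <;> simp [sq_nonneg])

theorem tendsto_of_summable_sq (hp : Summable fun n => p n ^ 2) :
    Tendsto p cofinite (𝓝 0) := by
  have h := hp.tendsto_cofinite_zero.sqrt
  simp only [Real.sqrt_sq_eq_abs, Real.sqrt_zero] at h
  exact tendsto_zero_iff_abs_tendsto_zero p |>.2 h

theorem tailSq_nonneg (p : ℤ → ℝ) (n : ℤ) : 0 ≤ tailSq p n :=
  tsum_nonneg fun m => by split_ifs <;> positivity

theorem tailSq_pos (hp : Summable fun n => p n ^ 2)
    (hne : ∀ n, p n ≠ 0 ∨ p (n + 1) ≠ 0) (n : ℤ) : 0 < tailSq p n := by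
  have h1 := tailSq_sub_one hp (n + 1)
  have h2 := tailSq_sub_one hp (n + 1 + 1)
  rw [add_sub_cancel_right] at h1 h2
  have h3 := tailSq_nonneg p (n + 1 + 1)
  rcases hne (n + 1) with h | h
  · have := pow_pos (abs_pos.2 h) 2
    rw [sq_abs] at this
    nlinarith [sq_nonneg (p (n + 1 + 1))]
  · have := pow_pos (abs_pos.2 h) 2
    rw [sq_abs] at this
    nlinarith [sq_nonneg (p (n + 1))]

end tailSq

/-! ### Real eigenvectors and their limits at infinity -/

namespace JacobiCoeffs

/-- `p` is a real square-summable eigenvector of the Jacobi operator with eigenvalue `lam`. -/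
structure IsRealEigenvector (J : JacobiCoeffs) (lam : ℝ) (p : ℤ → ℝ) : Prop where
  ne_zero : p ≠ 0
  summable : Summable fun n => p n ^ 2
  eqn : ∀ n, J.a (n - 1) * p (n - 1) + J.a n * p (n + 1) + J.b n * p n = lam * p n

theorem a_tendsto_atTop (J : JacobiCoeffs) : Tendsto J.a atTop (𝓝 (-1)) :=
  J.a_tendsto.mono_left (Int.cofinite_eq ▸ le_sup_right)

theorem a_tendsto_atBot (J : JacobiCoeffs) : Tendsto J.a atBot (𝓝 (-1)) :=
  J.a_tendsto.mono_left (Int.cofinite_eq ▸ le_sup_left)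

theorem b_tendsto_atTop (J : JacobiCoeffs) : Tendsto J.b atTop (𝓝 0) :=
  J.b_tendsto.mono_left (Int.cofinite_eq ▸ le_sup_right)

theorem b_tendsto_atBot (J : JacobiCoeffs) : Tendsto J.b atBot (𝓝 0) :=
  J.b_tendsto.mono_left (Int.cofinite_eq ▸ le_sup_left)

namespace IsRealEigenvector

variable {J : JacobiCoeffs} {lam : ℝ} {p : ℤ → ℝ}

/-- Since `a` never vanishes, two consecutive zeros propagate through the three-term recursion in
both directions. -/
theorem ne_zero_or (hp : J.IsRealEigenvector lam p) (n : ℤ) : p n ≠ 0 ∨ p (n + 1) ≠ 0 := by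
  by_contra! h
  have key : ∀ m : ℕ, (p (n + m) = 0 ∧ p (n + m + 1) = 0) ∧ (p (n - m) = 0 ∧ p (n - m + 1) = 0) := by
    intro m
    induction m with
    | zero => simpa using h
    | succ m ih =>
      obtain ⟨⟨h1, h2⟩, h3, h4⟩ := ih
      have e1 := hp.eqn (n + m + 1)
      have e2 := hp.eqn (n - m)
      rw [add_sub_cancel_right, h1, h2] at e1
      rw [h3, h4] at e2
      have f1 : p (n + m + 1 + 1) = 0 := by
        simpa [(J.a_neg _).ne] using e1
      have f2 : p (n - m - 1) = 0 := by
        simpa [(J.a_neg _).ne] using e2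
      push_cast
      refine ⟨⟨by rwa [← add_assoc], by rwa [← add_assoc]⟩, by rwa [← sub_sub], ?_⟩
      rwa [← sub_sub, sub_add_cancel]
  apply hp.ne_zero
  funext m
  rcases le_total n m with hm | hm
  · have := (key (m - n).toNat).1.1
    rwa [Int.toNat_of_nonneg (by omega), add_sub_cancel] at this
  · have := (key (n - m).toNat).2.1
    rwa [Int.toNat_of_nonneg (by omega), sub_sub_cancel] at this

theorem tendsto_atTop (hp : J.IsRealEigenvector lam p) : Tendsto p atTop (𝓝 0) :=
  (tendsto_of_summable_sq hp.summable).mono_left (Int.cofinite_eq ▸ le_sup_right)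

theorem tendsto_atBot (hp : J.IsRealEigenvector lam p) : Tendsto p atBot (𝓝 0) :=
  (tendsto_of_summable_sq hp.summable).mono_left (Int.cofinite_eq ▸ le_sup_left)

theorem tailSq_pos (hp : J.IsRealEigenvector lam p) (n : ℤ) : 0 < tailSq p n :=
  _root_.tailSq_pos hp.summable hp.ne_zero_or n

theorem tailSq_eq_add (hp : J.IsRealEigenvector lam p) (n : ℤ) :
    tailSq p n = tailSq p (n + 1) + p (n + 1) ^ 2 := by
  have := tailSq_sub_one hp.summable (n + 1)
  rwa [add_sub_cancel_right] at this

theorem tsum_sq_pos (hp : J.IsRealEigenvector lam p) : 0 < ∑' n, p n ^ 2 := by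
  obtain ⟨n, hn⟩ := Function.ne_iff.1 hp.ne_zero
  exact hp.summable.tsum_pos (fun _ => sq_nonneg _) n (pow_two_pos_of_ne_zero hn)

theorem ratio_tendsto (hlam : lam ∉ Set.Icc (-2 : ℝ) 2) (hp : J.IsRealEigenvector lam p) :
    (∀ᶠ n in atTop, p n ≠ 0) ∧
      Tendsto (fun n => p (n + 1) / p n) atTop (𝓝 (eigenParam lam)⁻¹) := by
  obtain ⟨h1, h2⟩ := eigenParam_spec hlam
  exact ratio_tendsto_of_decaying h1 J.a_tendsto_atTop J.b_tendsto_atTop hp.tendsto_atTop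
    hp.ne_zero_or (fun n => by rw [← h2]; exact hp.eqn n)

theorem sq_div_tailSq_tendsto (hlam : lam ∉ Set.Icc (-2 : ℝ) 2)
    (hp : J.IsRealEigenvector lam p) :
    Tendsto (fun n => p n ^ 2 / tailSq p n) atTop (𝓝 (eigenParam lam ^ 2 - 1)) := by
  have hk0 : eigenParam lam ≠ 0 := by
    have := (eigenParam_spec hlam).1
    exact abs_pos.1 (by linarith)
  exact sq_div_tail_tendsto hk0 hp.tailSq_pos hp.tailSq_eq_add
    (tendsto_tailSq_atTop hp.summable) hp.tendsto_atTop (hp.ratio_tendsto hlam).1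
    (hp.ratio_tendsto hlam).2

theorem sq_div_tailSq_tendsto_atBot (hp : J.IsRealEigenvector lam p) :
    Tendsto (fun n => p n ^ 2 / tailSq p n) atBot (𝓝 0) := by
  have h := (hp.tendsto_atBot.pow 2).div (tendsto_tailSq_atBot hp.summable) hp.tsum_sq_pos.ne'
  rw [zero_pow two_ne_zero, zero_div] at h
  exact h

/-- The quotient has finite limits at both ends. The bound serves to show that transformed
eigenvectors are square summable. -/
theorem exists_sq_le_mul_tailSq (hlam : lam ∉ Set.Icc (-2 : ℝ) 2)
    (hp : J.IsRealEigenvector lam p) : ∃ M, ∀ n, p n ^ 2 ≤ M * tailSq p n := by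
  have h : ∀ᶠ n in cofinite, p n ^ 2 / tailSq p n ≤ max 1 (eigenParam lam ^ 2) := by
    rw [Int.cofinite_eq, eventually_sup]
    constructor
    · exact (hp.sq_div_tailSq_tendsto_atBot.eventually (gt_mem_nhds one_pos)).mono
        fun n hn => hn.le.trans (le_max_left _ _)
    · exact ((hp.sq_div_tailSq_tendsto hlam).eventually (gt_mem_nhds (sub_one_lt _))).mono
        fun n hn => hn.le.trans (le_max_right _ _)
  have hb : IsBoundedUnder (· ≤ ·) cofinite fun n => p n ^ 2 / tailSq p n :=
    isBoundedUnder_of_eventually_le h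
  obtain ⟨M, hM⟩ := hb.bddAbove_range_of_cofinite
  exact ⟨M, fun n => (div_le_iff₀ (hp.tailSq_pos n)).1 (hM ⟨n, rfl⟩)⟩

/-- The current `a(n) p(n) p(n+1) / ∑_{m > n} p(m)²`. -/
noncomputable def _root_.JacobiCoeffs.current (J : JacobiCoeffs) (p : ℤ → ℝ) (n : ℤ) : ℝ :=
  J.a n * (p n * p (n + 1)) / tailSq p n

/-- The current factors as `a n * (p (n+1) / p n) * (p n² / c n)`, with limit `-k⁻¹ * (k² - 1)`. -/
theorem current_tendsto_atTop (hlam : lam ∉ Set.Icc (-2 : ℝ) 2)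
    (hp : J.IsRealEigenvector lam p) :
    Tendsto (J.current p) atTop (𝓝 (-(eigenParam lam - (eigenParam lam)⁻¹))) := by
  have hk0 : eigenParam lam ≠ 0 := by
    have := (eigenParam_spec hlam).1
    exact abs_pos.1 (by linarith)
  have := (J.a_tendsto_atTop.mul (hp.ratio_tendsto hlam).2).mul (hp.sq_div_tailSq_tendsto hlam)
  have h2 : -1 * (eigenParam lam)⁻¹ * (eigenParam lam ^ 2 - 1) =
      -(eigenParam lam - (eigenParam lam)⁻¹) := by
    field_simp
  rw [h2] at this
  refine this.congr' ?_
  filter_upwards [(hp.ratio_tendsto hlam).1] with n hn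
  have := (hp.tailSq_pos n).ne'
  rw [current]
  field_simp

theorem current_tendsto_atBot (hp : J.IsRealEigenvector lam p) :
    Tendsto (J.current p) atBot (𝓝 0) := by
  have := (J.a_tendsto_atBot.mul (hp.tendsto_atBot.mul
    (hp.tendsto_atBot.comp tendsto_int_add_one_atBot))).div (tendsto_tailSq_atBot hp.summable)
    hp.tsum_sq_pos.ne'
  rw [mul_zero, mul_zero, zero_div] at this
  exact this

theorem tailSq_ratio_tendsto_atTop (hlam : lam ∉ Set.Icc (-2 : ℝ) 2)
    (hp : J.IsRealEigenvector lam p) :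
    Tendsto (fun n => tailSq p (n - 1) / tailSq p n) atTop (𝓝 (eigenParam lam ^ 2)) := by
  have := (hp.sq_div_tailSq_tendsto hlam).const_add 1
  rw [add_sub_cancel] at this
  refine this.congr fun n => ?_
  have := (hp.tailSq_pos n).ne'
  rw [tailSq_sub_one hp.summable]
  field_simp

theorem tailSq_ratio_tendsto_atBot (hp : J.IsRealEigenvector lam p) :
    Tendsto (fun n => tailSq p (n - 1) / tailSq p n) atBot (𝓝 1) := by
  have := hp.sq_div_tailSq_tendsto_atBot.const_add 1
  rw [add_zero] at this
  refine this.congr fun n => ?_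
  have := (hp.tailSq_pos n).ne'
  rw [tailSq_sub_one hp.summable]
  field_simp

/-- As a quotient of consecutive values of one ratio, the factor multiplying `a n ^ 2` tends to 1 at
both ends and has a telescoping logarithm. -/
theorem tailSq_double_ratio (hp : J.IsRealEigenvector lam p) (n : ℤ) :
    tailSq p (n - 1) * tailSq p (n + 1) / tailSq p n ^ 2 =
      tailSq p (n - 1) / tailSq p n * (tailSq p (n + 1 - 1) / tailSq p (n + 1))⁻¹ := by
  have h1 := (hp.tailSq_pos n).ne'
  have h2 := (hp.tailSq_pos (n + 1)).ne'
  rw [add_sub_cancel_right]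
  field_simp

end IsRealEigenvector

/-! ### Removal of one eigenvalue -/

/-- The double commutation transform of a Jacobi operator: it removes the outer eigenvalue `lam`
with eigenvector `p`. -/
noncomputable def removeEigenvalue (J : JacobiCoeffs) {lam : ℝ} {p : ℤ → ℝ}
    (hlam : lam ∉ Set.Icc (-2 : ℝ) 2) (hp : J.IsRealEigenvector lam p) : JacobiCoeffs where
  a n := J.a n * (√(tailSq p (n - 1) * tailSq p (n + 1)) / tailSq p n)
  b n := J.b n + (J.current p (n - 1) - J.current p n)
  a_neg n := by
    have h0 := hp.tailSq_pos (n - 1)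
    have h1 := hp.tailSq_pos n
    have h2 := hp.tailSq_pos (n + 1)
    exact mul_neg_of_neg_of_pos (J.a_neg n) (by positivity)
  a_tendsto := by
    have hk0 : eigenParam lam ≠ 0 := by
      have := (eigenParam_spec hlam).1
      exact abs_pos.1 (by linarith)
    have hsqrt : ∀ n, √(tailSq p (n - 1) / tailSq p n *
        (tailSq p (n + 1 - 1) / tailSq p (n + 1))⁻¹) =
          √(tailSq p (n - 1) * tailSq p (n + 1)) / tailSq p n := fun n => by
      rw [← hp.tailSq_double_ratio, Real.sqrt_div' _ (by positivity),
        Real.sqrt_sq (hp.tailSq_pos n).le]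
    rw [Int.cofinite_eq, tendsto_sup]
    constructor
    · have h := hp.tailSq_ratio_tendsto_atBot
      have h2 := (h.mul ((h.comp tendsto_int_add_one_atBot).inv₀ one_ne_zero)).sqrt
      have := J.a_tendsto_atBot.mul (h2.congr hsqrt)
      simpa using this
    · have h := hp.tailSq_ratio_tendsto_atTop hlam
      have h2 := (h.mul ((h.comp tendsto_int_add_one_atTop).inv₀ (pow_ne_zero 2 hk0))).sqrt
      have := J.a_tendsto_atTop.mul (h2.congr hsqrt)
      rwa [mul_inv_cancel₀ (pow_ne_zero 2 hk0), Real.sqrt_one, mul_one] at this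
  b_tendsto := by
    rw [Int.cofinite_eq, tendsto_sup]
    constructor
    · have h := hp.current_tendsto_atBot
      simpa using J.b_tendsto_atBot.add ((h.comp tendsto_int_sub_one_atBot).sub h)
    · have h := hp.current_tendsto_atTop hlam
      simpa using J.b_tendsto_atTop.add ((h.comp tendsto_int_sub_one_atTop).sub h)

/-- The contribution of the site `n` to the right-hand side of the inequality. -/
noncomputable def cost (J : JacobiCoeffs) (n : ℤ) : ℝ :=
  J.b n ^ 2 + 2 * (J.a n ^ 2 - 1 - Real.log (J.a n ^ 2))

theorem log_cost_nonneg (J : JacobiCoeffs) (n : ℤ) :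
    0 ≤ J.a n ^ 2 - 1 - Real.log (J.a n ^ 2) := by
  have := Real.log_le_sub_one_of_pos (pow_two_pos_of_ne_zero (J.a_neg n).ne)
  linarith

theorem cost_nonneg (J : JacobiCoeffs) (n : ℤ) : 0 ≤ J.cost n := by
  have := J.log_cost_nonneg n
  unfold cost
  positivity

section removal

variable {J : JacobiCoeffs} {lam : ℝ} {p : ℤ → ℝ}

theorem removeEigenvalue_a_sq (hlam : lam ∉ Set.Icc (-2 : ℝ) 2)
    (hp : J.IsRealEigenvector lam p) (n : ℤ) :
    (J.removeEigenvalue hlam hp).a n ^ 2 =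
      J.a n ^ 2 * (tailSq p (n - 1) * tailSq p (n + 1) / tailSq p n ^ 2) := by
  have h0 := hp.tailSq_pos (n - 1)
  have h2 := hp.tailSq_pos (n + 1)
  simp only [removeEigenvalue]
  rw [mul_pow, div_pow, Real.sq_sqrt (by positivity)]

/-- The telescoping quantity governing the change of `cost` under eigenvalue removal. -/
noncomputable def removalPotential (J : JacobiCoeffs) (lam : ℝ) (p : ℤ → ℝ) (n : ℤ) : ℝ :=
  2 * lam * J.current p n - 2 * (J.a n ^ 2 * (p n ^ 2 / tailSq p n)) + J.current p n ^ 2 -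
    2 * Real.log (tailSq p (n + 1 - 1) / tailSq p (n + 1))

/-- Primes refer to neighbours: `a'` and `p''` sit at `n - 1`, `p'` at `n + 1`. With `c`, `c + p²`
and `c - p'²` the tails at `n`, `n - 1` and `n + 1`, the failure to telescope is a multiple of the
residual of the eigenvalue equation, so it vanishes for an eigenvector. -/
theorem cost_telescoping_identity (a a' b lam p p' p'' : ℝ) {c : ℝ} (hc : c ≠ 0)
    (hd : c + p ^ 2 ≠ 0) :
    b ^ 2 + 2 * a ^ 2 - ((b + (a' * (p'' * p) / (c + p ^ 2) - a * (p * p') / c)) ^ 2 +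
      2 * (a ^ 2 * ((c + p ^ 2) * (c - p' ^ 2) / c ^ 2)) +
      ((2 * lam * (a * (p * p') / c) - 2 * (a ^ 2 * (p ^ 2 / c)) + (a * (p * p') / c) ^ 2) -
      (2 * lam * (a' * (p'' * p) / (c + p ^ 2)) - 2 * (a' ^ 2 * (p'' ^ 2 / (c + p ^ 2))) +
        (a' * (p'' * p) / (c + p ^ 2)) ^ 2))) =
    -2 * (a' * p'' / (c + p ^ 2) - a * p' / c) * (a' * p'' + a * p' + b * p - lam * p) := by
  field_simp
  ring

/-- The residual of the transformed equation, cleared of square roots, is a combination of three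
quantities that vanish: the residuals for `u` and for `p`, and the Wronskian relation defining `s`.
-/
theorem transformed_eqn_identity (a a' b lam mu p p' p'' u u' u'' s : ℝ) {c : ℝ} (hc : c ≠ 0)
    (hd : c + p ^ 2 ≠ 0) :
    a * ((c + p ^ 2) / c) * (c * u' - p' * s) +
      a' * (c / (c + p ^ 2)) * ((c + p ^ 2) * u'' - p'' * (s + p * u)) +
      (b + (a' * (p'' * p) / (c + p ^ 2) - a * (p * p') / c)) * (c * u - p * s) -
      mu * (c * u - p * s) =
    c * (a' * u'' + a * u' + b * u - mu * u) - s * (a' * p'' + a * p' + b * p - lam * p) +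
      p * (a * (p * u' - p' * u) - (lam - mu) * s) := by
  field_simp
  ring

theorem cost_eq (hlam : lam ∉ Set.Icc (-2 : ℝ) 2) (hp : J.IsRealEigenvector lam p) (n : ℤ) :
    J.cost n = (J.removeEigenvalue hlam hp).cost n +
      (J.removalPotential lam p n - J.removalPotential lam p (n - 1)) := by
  have hd : tailSq p (n - 1) = tailSq p n + p n ^ 2 := tailSq_sub_one hp.summable n
  have hc := hp.tailSq_eq_add n
  have c0 := hp.tailSq_pos (n - 1)
  have c1 := hp.tailSq_pos n
  have c2 := hp.tailSq_pos (n + 1)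
  have ha : J.a n ^ 2 ≠ 0 := pow_ne_zero 2 (J.a_neg n).ne
  have hlog : Real.log ((J.removeEigenvalue hlam hp).a n ^ 2) = Real.log (J.a n ^ 2) +
      (Real.log (tailSq p (n - 1) / tailSq p n) -
        Real.log (tailSq p (n + 1 - 1) / tailSq p (n + 1))) := by
    rw [removeEigenvalue_a_sq, hp.tailSq_double_ratio, Real.log_mul ha, Real.log_mul,
      Real.log_inv]
    · ring
    · positivity
    · rw [add_sub_cancel_right]
      positivity
    · rw [add_sub_cancel_right]
      positivity
  have hcost : J.b n ^ 2 + 2 * J.a n ^ 2 =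
      (J.removeEigenvalue hlam hp).b n ^ 2 + 2 * (J.removeEigenvalue hlam hp).a n ^ 2 +
      ((2 * lam * J.current p n - 2 * (J.a n ^ 2 * (p n ^ 2 / tailSq p n)) + J.current p n ^ 2) -
      (2 * lam * J.current p (n - 1) - 2 * (J.a (n - 1) ^ 2 * (p (n - 1) ^ 2 / tailSq p (n - 1)))
        + J.current p (n - 1) ^ 2)) := by
    rw [removeEigenvalue_a_sq]
    simp only [removeEigenvalue, current, sub_add_cancel]
    have e := hp.eqn n
    have hc' : tailSq p (n + 1) = tailSq p n - p (n + 1) ^ 2 := by linarith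
    rw [hc', hd]
    rw [hd] at c0
    refine sub_eq_zero.1 ((cost_telescoping_identity (J.a n) (J.a (n - 1)) (J.b n) lam (p n)
      (p (n + 1)) (p (n - 1)) c1.ne' c0.ne').trans ?_)
    rw [e, sub_self, mul_zero]
  unfold cost removalPotential
  rw [hlog, sub_add_cancel]
  linear_combination hcost

theorem removalPotential_tendsto_atTop (hlam : lam ∉ Set.Icc (-2 : ℝ) 2)
    (hp : J.IsRealEigenvector lam p) :
    Tendsto (J.removalPotential lam p) atTop (𝓝 (eigenTerm lam)) := by
  obtain ⟨hk, hk'⟩ := eigenParam_spec hlam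
  have hk0 : eigenParam lam ≠ 0 := abs_pos.1 (by linarith)
  have h1 := hp.current_tendsto_atTop hlam
  have h2 := (J.a_tendsto_atTop.pow 2).mul (hp.sq_div_tailSq_tendsto hlam)
  have h3 := ((hp.tailSq_ratio_tendsto_atTop hlam).comp tendsto_int_add_one_atTop).log
    (pow_ne_zero 2 hk0)
  have h : Tendsto (J.removalPotential lam p) atTop _ :=
    (((h1.const_mul (2 * lam)).sub (h2.const_mul 2)).add (h1.pow 2)).sub (h3.const_mul 2)
  convert h using 2
  have hl : Real.log (|eigenParam lam| ^ 4) = 2 * Real.log (eigenParam lam ^ 2) := by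
    rw [show |eigenParam lam| ^ 4 = (eigenParam lam ^ 2) ^ 2 by
      rw [← sq_abs (eigenParam lam)]; ring, Real.log_pow]
    norm_num
  rw [eigenTerm, hl]
  -- With `lam = -k - 1/k` the algebraic terms are `2(k² - k⁻²) - 2(k² - 1) + (k - k⁻¹)² = k² -
  -- k⁻²`.
  generalize eigenParam lam = k at hk0 hk'
  rw [hk']
  field_simp
  ring

theorem removalPotential_tendsto_atBot (hp : J.IsRealEigenvector lam p) :
    Tendsto (J.removalPotential lam p) atBot (𝓝 0) := by
  have h1 := hp.current_tendsto_atBot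
  have h2 := (J.a_tendsto_atBot.pow 2).mul hp.sq_div_tailSq_tendsto_atBot
  have h3 := (hp.tailSq_ratio_tendsto_atBot.comp tendsto_int_add_one_atBot).log one_ne_zero
  have h : Tendsto (J.removalPotential lam p) atBot _ :=
    (((h1.const_mul (2 * lam)).sub (h2.const_mul 2)).add (h1.pow 2)).sub (h3.const_mul 2)
  convert h using 2
  simp

theorem hasSum_cost_of_removeEigenvalue (hlam : lam ∉ Set.Icc (-2 : ℝ) 2)
    (hp : J.IsRealEigenvector lam p) {T : ℝ} (h : HasSum (J.removeEigenvalue hlam hp).cost T) :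
    HasSum J.cost (T + eigenTerm lam) := by
  simpa using hasSum_int_of_telescoping J.cost_nonneg h (cost_eq hlam hp)
    (removalPotential_tendsto_atTop hlam hp) (removalPotential_tendsto_atBot hp)

theorem hasSum_cost_removeEigenvalue (hlam : lam ∉ Set.Icc (-2 : ℝ) 2)
    (hp : J.IsRealEigenvector lam p) {T : ℝ} (h : HasSum J.cost T) :
    HasSum (J.removeEigenvalue hlam hp).cost (T - eigenTerm lam) := by
  have := hasSum_int_of_telescoping (J.removeEigenvalue hlam hp).cost_nonneg h
    (K := fun n => -J.removalPotential lam p n)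
    (fun n => by rw [cost_eq hlam hp n]; ring)
    (removalPotential_tendsto_atTop hlam hp).neg (removalPotential_tendsto_atBot hp).neg
  simpa [sub_eq_add_neg] using this

/-- Eigenvectors for the other eigenvalues survive the removal of `lam`. -/
theorem exists_isRealEigenvector_removeEigenvalue (hlam : lam ∉ Set.Icc (-2 : ℝ) 2)
    (hp : J.IsRealEigenvector lam p) {mu : ℝ} {u : ℤ → ℝ} (hmu : mu ≠ lam)
    (hu : J.IsRealEigenvector mu u) :
    ∃ v, (J.removeEigenvalue hlam hp).IsRealEigenvector mu v := by
  have hsub : lam - mu ≠ 0 := sub_ne_zero.2 hmu.symm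
  -- The rescaled Wronskian `s` plays the role of the tail sum of `p * u`; its vanishing at `-∞`
  -- expresses the orthogonality of `p` and `u`.
  obtain ⟨s, hs⟩ : ∃ s : ℤ → ℝ,
      ∀ n, s n = J.a n * (p n * u (n + 1) - p (n + 1) * u n) / (lam - mu) := ⟨_, fun _ => rfl⟩
  have hw : ∀ n, J.a n * (p n * u (n + 1) - p (n + 1) * u n) = (lam - mu) * s n := fun n => by
    rw [hs]
    field_simp
  have hs1 : ∀ n, s (n - 1) = s n + p n * u n := by
    intro n
    have h1 := hw n
    have h2 := hw (n - 1)
    rw [sub_add_cancel] at h2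
    refine mul_left_cancel₀ hsub ?_
    linear_combination h1 - h2 + u n * hp.eqn n - p n * hu.eqn n
  have hs_bot : Tendsto s atBot (𝓝 0) := by
    have := (J.a_tendsto_atBot.mul ((hp.tendsto_atBot.mul
      (hu.tendsto_atBot.comp tendsto_int_add_one_atBot)).sub
      ((hp.tendsto_atBot.comp tendsto_int_add_one_atBot).mul hu.tendsto_atBot))).div_const
      (lam - mu)
    refine Tendsto.congr (fun n => (hs n).symm) ?_
    simpa using this
  have hsq : ∀ n, √(tailSq p n) ^ 2 = tailSq p n := fun n => Real.sq_sqrt (hp.tailSq_pos n).le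
  have hsqpos : ∀ n, 0 < √(tailSq p n) := fun n => Real.sqrt_pos.2 (hp.tailSq_pos n)
  -- This is `u - p * s / c` rescaled by `√(c n / c (n-1))`.
  set v : ℤ → ℝ := fun n =>
    (tailSq p n * u n - p n * s n) / (√(tailSq p (n - 1)) * √(tailSq p n)) with hv
  refine ⟨v, ?_, ?_, ?_⟩
  · intro hv0
    have hN : ∀ n, tailSq p n * u n = p n * s n := by
      intro n
      have := congrFun hv0 n
      simp only [hv, Pi.zero_apply, div_eq_zero_iff, mul_eq_zero, (hsqpos _).ne', or_self,
        or_false] at this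
      linarith
    -- If `v = 0` then `s / c` is constant, hence 0 by its limit at `-∞`, and `u = 0` follows.
    set R : ℤ → ℝ := fun n => s n / tailSq p n with hR
    have hstep : ∀ n, R (n - 1) = R n := by
      intro n
      simp only [hR]
      rw [div_eq_div_iff (hp.tailSq_pos _).ne' (hp.tailSq_pos _).ne', hs1,
        tailSq_sub_one hp.summable]
      linear_combination p n * hN n
    have hR_bot : Tendsto R atBot (𝓝 0) := by
      have h := hs_bot.div (tendsto_tailSq_atBot hp.summable) hp.tsum_sq_pos.ne'
      rw [zero_div] at h
      exact h
    have hR0 : ∀ n, R n = 0 := eq_of_sub_one_invariant hstep hR_bot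
    apply hu.ne_zero
    funext n
    have h1 : s n = 0 := by
      have := hR0 n
      simpa [hR, (hp.tailSq_pos n).ne'] using this
    have := hN n
    rw [h1, mul_zero] at this
    simpa [(hp.tailSq_pos n).ne'] using this
  · obtain ⟨M, hM⟩ := hp.exists_sq_le_mul_tailSq hlam
    obtain ⟨A, hA⟩ := (J.a_tendsto.pow 2).bddAbove_range_of_cofinite
    have hA' : ∀ n, J.a n ^ 2 ≤ A := fun n => hA ⟨n, rfl⟩
    -- Suffices because `v n² = u n² + s n² / c n - s (n-1)² / c (n-1)`.
    have hssum : Summable fun n => s n ^ 2 / tailSq p n := by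
      have h1 : Summable fun n : ℤ => u (n + 1) ^ 2 :=
        hu.summable.comp_injective (add_left_injective (1 : ℤ))
      refine (((h1.mul_left M).add hu.summable).mul_left
        (2 * A / (lam - mu) ^ 2)).of_nonneg_of_le (fun n => ?_) fun n => ?_
      · have := hp.tailSq_pos n
        positivity
      · have hc := hp.tailSq_pos n
        have h2 : p (n + 1) ^ 2 ≤ tailSq p n := by
          rw [hp.tailSq_eq_add n]
          linarith [hp.tailSq_pos (n + 1)]
        have hA0 : 0 ≤ A := (sq_nonneg _).trans (hA' n)
        have h3 : (p n * u (n + 1) - p (n + 1) * u n) ^ 2 ≤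
            2 * (tailSq p n * (M * u (n + 1) ^ 2 + u n ^ 2)) := by
          nlinarith [mul_le_mul_of_nonneg_right (hM n) (sq_nonneg (u (n + 1))),
            mul_le_mul_of_nonneg_right h2 (sq_nonneg (u n)),
            sq_nonneg (p n * u (n + 1) + p (n + 1) * u n)]
        simp only [hs, div_pow, mul_pow]
        rw [div_div, div_le_iff₀ (by positivity)]
        calc J.a n ^ 2 * (p n * u (n + 1) - p (n + 1) * u n) ^ 2
            ≤ A * (2 * (tailSq p n * (M * u (n + 1) ^ 2 + u n ^ 2))) :=
              mul_le_mul (hA' n) h3 (sq_nonneg _) hA0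
          _ = _ := by field_simp
    have hssum' : Summable fun n : ℤ => s (n - 1) ^ 2 / tailSq p (n - 1) :=
      hssum.comp_injective (sub_left_injective (b := (1 : ℤ)))
    refine ((hu.summable.add hssum).sub hssum').congr fun n => ?_
    have h1 := hp.tailSq_pos n
    have h2 := hp.tailSq_pos (n - 1)
    simp only [hv]
    rw [div_pow, mul_pow, hsq, hsq, hs1]
    rw [tailSq_sub_one hp.summable] at h2 ⊢
    field_simp
    ring
  · intro n
    have c1 := hp.tailSq_pos n
    have c0 := hp.tailSq_pos (n - 1)
    have hd := tailSq_sub_one hp.summable n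
    -- The numerator of `v (n + 1)` is unchanged when `c` and `s` are taken at `n`, so the equation
    -- at `n` involves only `s n` and `s (n - 1)`.
    have hN : tailSq p (n + 1) * u (n + 1) - p (n + 1) * s (n + 1) =
        tailSq p n * u (n + 1) - p (n + 1) * s n := by
      have h1 := hp.tailSq_eq_add n
      have h2 := hs1 (n + 1)
      rw [add_sub_cancel_right] at h2
      rw [h1, h2]
      ring
    have key := transformed_eqn_identity (J.a n) (J.a (n - 1)) (J.b n) lam mu (p n) (p (n + 1))
      (p (n - 1)) (u n) (u (n + 1)) (u (n - 1)) (s n) c1.ne' (hd ▸ c0.ne')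
    rw [hp.eqn n, hu.eqn n, hw n, sub_self, sub_self, sub_self, mul_zero, mul_zero, mul_zero,
      ← hs1, ← hd] at key
    simp only [hv, removeEigenvalue, current, sub_add_cancel, add_sub_cancel_right]
    rw [hN, Real.sqrt_mul (hp.tailSq_pos _).le, Real.sqrt_mul (hp.tailSq_pos _).le]
    have r0 := (hsqpos (n - 1 - 1)).ne'
    have r1 := (hsqpos (n - 1)).ne'
    have r2 := (hsqpos n).ne'
    have r3 := (hsqpos (n + 1)).ne'
    have e1 : J.a (n - 1) * (√(tailSq p (n - 1 - 1)) * √(tailSq p n) / tailSq p (n - 1)) *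
        ((tailSq p (n - 1) * u (n - 1) - p (n - 1) * s (n - 1)) /
          (√(tailSq p (n - 1 - 1)) * √(tailSq p (n - 1)))) =
        J.a (n - 1) * (tailSq p n / tailSq p (n - 1)) *
          (tailSq p (n - 1) * u (n - 1) - p (n - 1) * s (n - 1)) /
          (√(tailSq p (n - 1)) * √(tailSq p n)) := by
      generalize tailSq p (n - 1) * u (n - 1) - p (n - 1) * s (n - 1) = X
      have h2 := hsq n
      field_simp
      rw [h2]
      ring
    have e2 : J.a n * (√(tailSq p (n - 1)) * √(tailSq p (n + 1)) / tailSq p n) *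
        ((tailSq p n * u (n + 1) - p (n + 1) * s n) /
          (√(tailSq p n) * √(tailSq p (n + 1)))) =
        J.a n * (tailSq p (n - 1) / tailSq p n) *
          (tailSq p n * u (n + 1) - p (n + 1) * s n) /
          (√(tailSq p (n - 1)) * √(tailSq p n)) := by
      generalize tailSq p n * u (n + 1) - p (n + 1) * s n = X
      have h2 := hsq (n - 1)
      field_simp
      rw [h2]
      ring
    rw [e1, e2]
    linear_combination key / (√(tailSq p (n - 1)) * √(tailSq p n))

end removal

end JacobiCoeffs

/-! ### The inequality -/

/-- With `t = log k² > 0` the term equals `2 * sinh t - 2 * t`. -/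
theorem eigenTerm_pos {lam : ℝ} (hlam : lam ∉ Set.Icc (-2 : ℝ) 2) : 0 < eigenTerm lam := by
  have hk := (eigenParam_spec hlam).1
  have hl : Real.log (|eigenParam lam| ^ 4) = 2 * Real.log (eigenParam lam ^ 2) := by
    rw [show |eigenParam lam| ^ 4 = (eigenParam lam ^ 2) ^ 2 by
      rw [← sq_abs (eigenParam lam)]; ring, Real.log_pow]
    norm_num
  have h1 : 1 < eigenParam lam ^ 2 := (one_lt_sq_iff_one_lt_abs _).2 hk
  have h2 := Real.self_lt_sinh_iff.2 (Real.log_pos h1)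
  rw [Real.sinh_log (by linarith)] at h2
  rw [eigenTerm, hl, one_div]
  linarith

namespace JacobiCoeffs

/-- The coefficients and `lam` are real, so the real and imaginary parts of a complex eigenvector
solve the same equation, and one of them is nonzero. -/
theorem mem_outerEigenvalues_iff (J : JacobiCoeffs) (lam : ℝ) :
    lam ∈ J.outerEigenvalues ↔
      lam ∉ Set.Icc (-2 : ℝ) 2 ∧ ∃ p, J.IsRealEigenvector lam p := by
  have h2 : 0 < (2 : ℝ≥0∞).toReal := by norm_num
  refine and_congr_right fun _ => ⟨fun h => ?_, ?_⟩
  · obtain ⟨v, hv⟩ := h.exists_hasEigenvector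
    have heq : ∀ n, (J.a (n - 1) : ℂ) * v (n - 1) + (J.a n : ℂ) * v (n + 1) + (J.b n : ℂ) * v n =
        (lam : ℂ) * v n := by
      intro n
      have h1 : J.op v = (lam : ℂ) • v := hv.apply_eq_smul
      rw [← J.op_apply, h1]
      rfl
    have hsum : Summable fun n => ‖v n‖ ^ 2 := by
      simpa using (lp.memℓp v).summable h2
    by_cases hre : (fun n => (v n).re) = 0
    · refine ⟨fun n => (v n).im, ?_, ?_, fun n => ?_⟩
      · intro him
        apply hv.2
        ext n
        exact Complex.ext (congrFun hre n) (congrFun him n)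
      · refine hsum.of_nonneg_of_le (fun n => sq_nonneg _) fun n => ?_
        exact sq_le_sq.2 (by simpa using Complex.abs_im_le_norm (v n))
      · simpa using congrArg Complex.im (heq n)
    · refine ⟨fun n => (v n).re, hre, ?_, fun n => ?_⟩
      · refine hsum.of_nonneg_of_le (fun n => sq_nonneg _) fun n => ?_
        exact sq_le_sq.2 (by simpa using Complex.abs_re_le_norm (v n))
      · simpa using congrArg Complex.re (heq n)
  · rintro ⟨p, hp⟩
    have hmem : Memℓp (fun n => (p n : ℂ)) 2 := by
      rw [memℓp_gen_iff h2]
      simpa using hp.summable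
    refine Module.End.hasEigenvalue_of_hasEigenvector
      (x := (⟨fun n => (p n : ℂ), hmem⟩ : ℓ²(ℤ, ℂ))) ⟨?_, ?_⟩
    · rw [Module.End.mem_eigenspace_iff]
      ext n
      change (J.a (n - 1) : ℂ) * p (n - 1) + (J.a n : ℂ) * p (n + 1) + (J.b n : ℂ) * p n =
        (lam : ℂ) * p n
      exact_mod_cast hp.eqn n
    · intro h0
      apply hp.ne_zero
      funext n
      have := congrArg (fun v : ℓ²(ℤ, ℂ) => v n) h0
      simpa using this

/-- Induction on `F` with the operator left general, since each step passes to the operator with one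
eigenvalue removed and its cost reduced accordingly. -/
theorem sum_eigenTerm_le (F : Finset ℝ) : ∀ (J : JacobiCoeffs) {T : ℝ}, HasSum J.cost T →
    (∀ lam ∈ F, lam ∉ Set.Icc (-2 : ℝ) 2 ∧ ∃ p, J.IsRealEigenvector lam p) →
    ∑ lam ∈ F, eigenTerm lam ≤ T := by
  induction F using Finset.induction_on with
  | empty =>
    intro J T hT _
    simpa using hT.nonneg J.cost_nonneg
  | insert lam F hF ih =>
    intro J T hT h
    obtain ⟨hlam, p, hp⟩ := h lam (Finset.mem_insert_self _ _)
    have := ih (J.removeEigenvalue hlam hp) (hasSum_cost_removeEigenvalue hlam hp hT) ?_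
    · rw [Finset.sum_insert hF]
      linarith
    · intro mu hmu
      obtain ⟨h1, u, hu⟩ := h mu (Finset.mem_insert_of_mem hmu)
      refine ⟨h1, exists_isRealEigenvector_removeEigenvalue hlam hp ?_ hu⟩
      rintro rfl
      exact hF hmu

theorem sum_outerEigenvalues_le (J : JacobiCoeffs) {T : ℝ} (hT : HasSum J.cost T)
    (s : Finset J.outerEigenvalues) : ∑ lam ∈ s, eigenTerm lam ≤ T := by
  have := sum_eigenTerm_le (s.map (Function.Embedding.subtype _)) J hT (fun lam hlam => by
    obtain ⟨x, -, rfl⟩ := Finset.mem_map.1 hlam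
    exact (J.mem_outerEigenvalues_iff x).1 x.2)
  simpa using this

theorem hasSum_cost {J : JacobiCoeffs} (hb : Summable fun n : ℤ => J.b n ^ 2)
    (ha : Summable fun n : ℤ => J.a n ^ 2 - 1 - Real.log (J.a n ^ 2)) :
    HasSum J.cost ((∑' n : ℤ, J.b n ^ 2) +
      2 * ∑' n : ℤ, (J.a n ^ 2 - 1 - Real.log (J.a n ^ 2))) :=
  hb.hasSum.add (ha.hasSum.mul_left 2)

theorem summable_of_summable_cost {J : JacobiCoeffs} (h : Summable J.cost) :
    Summable (fun n : ℤ => J.b n ^ 2) ∧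
      Summable fun n : ℤ => J.a n ^ 2 - 1 - Real.log (J.a n ^ 2) := by
  constructor
  · refine h.of_nonneg_of_le (fun n => sq_nonneg _) fun n => ?_
    have := J.log_cost_nonneg n
    unfold cost
    linarith
  · refine h.of_nonneg_of_le J.log_cost_nonneg fun n => ?_
    have := J.log_cost_nonneg n
    unfold cost
    nlinarith [sq_nonneg (J.b n)]

theorem eigenTerm_summable_and_tsum_le (J : JacobiCoeffs) {T : ℝ} (hT : HasSum J.cost T) :
    Summable (fun lam : J.outerEigenvalues => eigenTerm lam) ∧
      (∑' lam : J.outerEigenvalues, eigenTerm lam) ≤ T := by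
  have hpos : ∀ lam : J.outerEigenvalues, 0 ≤ eigenTerm lam := fun lam =>
    (eigenTerm_pos lam.2.1).le
  have hsum : Summable (fun lam : J.outerEigenvalues => eigenTerm lam) :=
    summable_of_sum_le hpos (J.sum_outerEigenvalues_le hT)
  exact ⟨hsum, hsum.tsum_le_of_sum_le (J.sum_outerEigenvalues_le hT)⟩

end JacobiCoeffs

/-! ### Hyperbolic sequences -/

theorem Real.tanh_eq_one_sub (x : ℝ) : Real.tanh x = 1 - 2 / (Real.exp (2 * x) + 1) := by
  have h : Real.exp (2 * x) = Real.exp x ^ 2 := by rw [← Real.exp_nat_mul]; norm_num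
  have hx := Real.exp_pos x
  rw [Real.tanh_eq_sinh_div_cosh, Real.sinh_eq, Real.cosh_eq, Real.exp_neg, h]
  field_simp
  ring

theorem Real.tendsto_tanh_atTop_one : Tendsto Real.tanh atTop (𝓝 1) := by
  have h : Tendsto (fun x : ℝ => Real.exp (2 * x) + 1) atTop atTop :=
    tendsto_atTop_add_const_right _ _
      (Real.tendsto_exp_atTop.comp (tendsto_id.const_mul_atTop two_pos))
  have := (h.const_div_atTop 2).const_sub 1
  rw [sub_zero] at this
  exact this.congr fun x => (Real.tanh_eq_one_sub x).symm

theorem Real.tendsto_tanh_atBot_neg_one : Tendsto Real.tanh atBot (𝓝 (-1)) := by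
  have := (Real.tendsto_tanh_atTop_one.comp tendsto_neg_atBot_atTop).neg
  exact this.congr fun x => by simp [Real.tanh_neg]

/-- The sequence `cosh (ω n)`. -/
noncomputable def coshSeq (ω : ℝ) (n : ℤ) : ℝ := Real.cosh (ω * n)

/-- The sequence `tanh (ω n)`. -/
noncomputable def tanhSeq (ω : ℝ) (n : ℤ) : ℝ := Real.tanh (ω * n)

section hyperbolic

variable (ω : ℝ)

theorem coshSeq_pos (n : ℤ) : 0 < coshSeq ω n := Real.cosh_pos _

theorem sinh_eq_tanhSeq_mul (n : ℤ) : Real.sinh (ω * n) = tanhSeq ω n * coshSeq ω n := by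
  rw [tanhSeq, coshSeq, Real.tanh_eq_sinh_div_cosh, div_mul_cancel₀ _ (Real.cosh_pos _).ne']

theorem coshSeq_add_one (n : ℤ) :
    coshSeq ω (n + 1) = coshSeq ω n * (Real.cosh ω + tanhSeq ω n * Real.sinh ω) := by
  have h : ω * ((n + 1 : ℤ) : ℝ) = ω * n + ω := by push_cast; ring
  rw [coshSeq, h, Real.cosh_add, sinh_eq_tanhSeq_mul, ← coshSeq]
  ring

theorem coshSeq_sub_one (n : ℤ) :
    coshSeq ω (n - 1) = coshSeq ω n * (Real.cosh ω - tanhSeq ω n * Real.sinh ω) := by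
  have h : ω * ((n - 1 : ℤ) : ℝ) = ω * n - ω := by push_cast; ring
  rw [coshSeq, h, Real.cosh_sub, sinh_eq_tanhSeq_mul, ← coshSeq]
  ring

theorem coshSeq_div_succ (n : ℤ) :
    coshSeq ω n / coshSeq ω (n + 1) = Real.cosh ω - tanhSeq ω (n + 1) * Real.sinh ω := by
  have h := coshSeq_sub_one ω (n + 1)
  rw [add_sub_cancel_right] at h
  rw [h, mul_div_cancel_left₀ _ (coshSeq_pos ω _).ne']

/-- This makes the squared soliton eigenvector a telescoping difference, so its tail sums are
explicit. -/
theorem tanhSeq_succ_sub (n : ℤ) :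
    tanhSeq ω (n + 1) - tanhSeq ω n = Real.sinh ω / (coshSeq ω n * coshSeq ω (n + 1)) := by
  have h1 := coshSeq_pos ω n
  have h2 := coshSeq_pos ω (n + 1)
  have h3 : Real.sinh ω = Real.sinh (ω * (n + 1 : ℤ) - ω * n) := by
    congr 1
    push_cast
    ring
  rw [Real.sinh_sub, sinh_eq_tanhSeq_mul, sinh_eq_tanhSeq_mul, ← coshSeq, ← coshSeq] at h3
  rw [h3]
  field_simp

theorem one_sub_tanhSeq (n : ℤ) : 1 - tanhSeq ω n = Real.exp (-(ω * n)) / coshSeq ω n := by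
  have h1 := coshSeq_pos ω n
  rw [eq_div_iff h1.ne', ← Real.cosh_sub_sinh, sinh_eq_tanhSeq_mul, ← coshSeq]
  ring

variable {ω}

theorem tanhSeq_tendsto_atTop (hω : 0 < ω) : Tendsto (tanhSeq ω) atTop (𝓝 1) :=
  Real.tendsto_tanh_atTop_one.comp (tendsto_intCast_atTop_atTop.const_mul_atTop hω)

theorem tanhSeq_tendsto_atBot (hω : 0 < ω) : Tendsto (tanhSeq ω) atBot (𝓝 (-1)) :=
  Real.tendsto_tanh_atBot_neg_one.comp
    ((tendsto_intCast_atBot_iff.2 tendsto_id).const_mul_atBot hω)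

theorem coshSeq_ratio_tendsto_atTop (hω : 0 < ω) :
    Tendsto (fun n => coshSeq ω n / coshSeq ω (n + 1)) atTop (𝓝 (Real.exp ω)⁻¹) := by
  have := (((tanhSeq_tendsto_atTop hω).comp tendsto_int_add_one_atTop).mul_const
    (Real.sinh ω)).const_sub (Real.cosh ω)
  rw [one_mul, Real.cosh_sub_sinh, Real.exp_neg] at this
  exact this.congr fun n => (coshSeq_div_succ ω n).symm

theorem coshSeq_ratio_tendsto_atBot (hω : 0 < ω) :
    Tendsto (fun n => coshSeq ω n / coshSeq ω (n + 1)) atBot (𝓝 (Real.exp ω)) := by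
  have := (((tanhSeq_tendsto_atBot hω).comp tendsto_int_add_one_atBot).mul_const
    (Real.sinh ω)).const_sub (Real.cosh ω)
  rw [neg_one_mul, sub_neg_eq_add, Real.cosh_add_sinh] at this
  exact this.congr fun n => (coshSeq_div_succ ω n).symm

end hyperbolic

/-! ### The one-soliton operator and equality -/

namespace JacobiCoeffs

theorem soliton_b_eq (ω : ℝ) (n : ℤ) :
    coshSeq ω n / coshSeq ω (n + 1) - coshSeq ω (n - 1) / coshSeq ω n =
      (tanhSeq ω n - tanhSeq ω (n + 1)) * Real.sinh ω := by
  have h := coshSeq_div_succ ω (n - 1)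
  rw [sub_add_cancel] at h
  rw [h, coshSeq_div_succ]
  ring

/-- The one-soliton Jacobi operator with eigenvalue `-2 cosh ω`. -/
noncomputable def soliton {ω : ℝ} (hω : 0 < ω) : JacobiCoeffs where
  a n := -(√(coshSeq ω n * coshSeq ω (n + 2)) / coshSeq ω (n + 1))
  b n := coshSeq ω n / coshSeq ω (n + 1) - coshSeq ω (n - 1) / coshSeq ω n
  a_neg n := by
    have h0 := coshSeq_pos ω n
    have h1 := coshSeq_pos ω (n + 1)
    have h2 := coshSeq_pos ω (n + 2)
    have : 0 < √(coshSeq ω n * coshSeq ω (n + 2)) / coshSeq ω (n + 1) := by positivity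
    linarith
  a_tendsto := by
    have hexp := (Real.exp_pos ω).ne'
    have hsqrt : ∀ n, -√(coshSeq ω n / coshSeq ω (n + 1) *
        (coshSeq ω (n + 1) / coshSeq ω (n + 1 + 1))⁻¹) =
          -(√(coshSeq ω n * coshSeq ω (n + 2)) / coshSeq ω (n + 1)) := fun n => by
      have h1 := coshSeq_pos ω (n + 1)
      rw [add_assoc n 1 1, one_add_one_eq_two, inv_div, div_mul_div_comm, ← sq,
        Real.sqrt_div' _ (by positivity), Real.sqrt_sq h1.le]
    rw [Int.cofinite_eq, tendsto_sup]
    constructor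
    · have h := coshSeq_ratio_tendsto_atBot hω
      have h2 := (h.mul ((h.comp tendsto_int_add_one_atBot).inv₀ hexp)).sqrt.neg
      rw [mul_inv_cancel₀ hexp, Real.sqrt_one] at h2
      exact h2.congr hsqrt
    · have h := coshSeq_ratio_tendsto_atTop hω
      have h2 := (h.mul ((h.comp tendsto_int_add_one_atTop).inv₀ (inv_ne_zero hexp))).sqrt.neg
      rw [mul_inv_cancel₀ (inv_ne_zero hexp), Real.sqrt_one] at h2
      exact h2.congr hsqrt
  b_tendsto := by
    simp only [soliton_b_eq]
    rw [Int.cofinite_eq, tendsto_sup]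
    constructor
    · have h := tanhSeq_tendsto_atBot hω
      simpa using (h.sub (h.comp tendsto_int_add_one_atBot)).mul_const (Real.sinh ω)
    · have h := tanhSeq_tendsto_atTop hω
      simpa using (h.sub (h.comp tendsto_int_add_one_atTop)).mul_const (Real.sinh ω)

/-- The eigenvector of the one-soliton operator. -/
noncomputable def solitonVec (ω : ℝ) (n : ℤ) : ℝ := (√(coshSeq ω n) * √(coshSeq ω (n + 1)))⁻¹

theorem solitonVec_sq (ω : ℝ) (n : ℤ) :
    solitonVec ω n ^ 2 = (coshSeq ω n * coshSeq ω (n + 1))⁻¹ := by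
  rw [solitonVec, inv_pow, mul_pow, Real.sq_sqrt (coshSeq_pos ω _).le,
    Real.sq_sqrt (coshSeq_pos ω _).le]

section soliton

variable {ω : ℝ} (hω : 0 < ω)

theorem soliton_a_mul_succ (n : ℤ) : (soliton hω).a n * solitonVec ω (n + 1) =
    -(coshSeq ω n / coshSeq ω (n + 1)) * solitonVec ω n := by
  have h0 := Real.sqrt_pos.2 (coshSeq_pos ω n)
  have h1 := Real.sqrt_pos.2 (coshSeq_pos ω (n + 1))
  have h2 := Real.sqrt_pos.2 (coshSeq_pos ω (n + 2))
  have h3 := Real.sq_sqrt (coshSeq_pos ω n).le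
  have h4 := coshSeq_pos ω (n + 1)
  simp only [soliton, solitonVec, add_assoc, one_add_one_eq_two]
  rw [Real.sqrt_mul (coshSeq_pos ω n).le]
  field_simp
  linear_combination -h3

theorem soliton_a_mul_pred (n : ℤ) : (soliton hω).a (n - 1) * solitonVec ω (n - 1) =
    -(coshSeq ω (n + 1) / coshSeq ω n) * solitonVec ω n := by
  have h0 := Real.sqrt_pos.2 (coshSeq_pos ω n)
  have h1 := Real.sqrt_pos.2 (coshSeq_pos ω (n + 1))
  have h2 := Real.sqrt_pos.2 (coshSeq_pos ω (n - 1))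
  have h3 := Real.sq_sqrt (coshSeq_pos ω (n + 1)).le
  have h4 := coshSeq_pos ω n
  simp only [soliton, solitonVec, sub_add_cancel]
  rw [show n - 1 + 2 = n + 1 by ring, Real.sqrt_mul (coshSeq_pos ω _).le]
  field_simp
  linear_combination -h3

theorem coshSeq_add_coshSeq (n : ℤ) :
    coshSeq ω (n + 1) + coshSeq ω (n - 1) = 2 * Real.cosh ω * coshSeq ω n := by
  rw [coshSeq_add_one, coshSeq_sub_one]
  ring

theorem soliton_isRealEigenvector :
    (soliton hω).IsRealEigenvector (-2 * Real.cosh ω) (solitonVec ω) where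
  ne_zero h := by
    have h1 := congrFun h 0
    have h2 := solitonVec_sq ω 0
    have h3 := coshSeq_pos ω 0
    have h4 := coshSeq_pos ω (0 + 1)
    rw [h1, Pi.zero_apply, zero_pow two_ne_zero] at h2
    exact absurd h2 (by positivity)
  summable := by
    have hs := (Real.sinh_pos_iff.2 hω)
    refine (hasSum_int_of_telescoping (fun n => sq_nonneg (solitonVec ω n))
      (hasSum_zero (α := ℝ)) (K := fun n => tanhSeq ω (n + 1) / Real.sinh ω) (fun n => ?_)
      (((tanhSeq_tendsto_atTop hω).comp tendsto_int_add_one_atTop).div_const _)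
      (((tanhSeq_tendsto_atBot hω).comp tendsto_int_add_one_atBot).div_const _)).summable
    rw [sub_add_cancel, ← sub_div, tanhSeq_succ_sub, solitonVec_sq]
    have h3 := coshSeq_pos ω n
    have h4 := coshSeq_pos ω (n + 1)
    field_simp
    ring
  eqn n := by
    have h := coshSeq_add_coshSeq (ω := ω) n
    have h3 := coshSeq_pos ω n
    have h4 := coshSeq_pos ω (n + 1)
    rw [soliton_a_mul_pred, soliton_a_mul_succ]
    simp only [soliton]
    field_simp
    linear_combination -solitonVec ω n * coshSeq ω (n + 1) * h

/-- Both sides have the same increments and vanish at `+∞`. -/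
theorem tailSq_solitonVec (hω : 0 < ω) (n : ℤ) :
    tailSq (solitonVec ω) n = (1 - tanhSeq ω (n + 1)) / Real.sinh ω := by
  have hs := (Real.sinh_pos_iff.2 hω)
  have hsum := (soliton_isRealEigenvector hω).summable
  refine sub_eq_zero.1 (eq_of_sub_one_invariant
    (f := fun n => tailSq (solitonVec ω) n - (1 - tanhSeq ω (n + 1)) / Real.sinh ω)
    (fun n => ?_) (l := atTop) ?_ n)
  · rw [tailSq_sub_one hsum, solitonVec_sq, sub_add_cancel]
    have h := tanhSeq_succ_sub ω n
    have h3 := coshSeq_pos ω n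
    have h4 := coshSeq_pos ω (n + 1)
    have h5 : (coshSeq ω n * coshSeq ω (n + 1))⁻¹ =
        (tanhSeq ω (n + 1) - tanhSeq ω n) / Real.sinh ω := by
      rw [h]
      field_simp
    rw [h5]
    ring
  · simpa using (tendsto_tailSq_atTop hsum).sub
      ((((tanhSeq_tendsto_atTop hω).comp tendsto_int_add_one_atTop).const_sub 1).div_const
        (Real.sinh ω))

theorem neg_two_cosh_notMem (hω : 0 < ω) : -2 * Real.cosh ω ∉ Set.Icc (-2 : ℝ) 2 := by
  intro h
  have := Real.one_lt_cosh.2 hω.ne'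
  linarith [h.1]

theorem current_soliton (n : ℤ) : (soliton hω).current (solitonVec ω) n =
    -(Real.sinh ω * (1 + tanhSeq ω (n + 1))) := by
  have hs := (Real.sinh_pos_iff.2 hω)
  have h3 := coshSeq_pos ω n
  have h4 := coshSeq_pos ω (n + 1)
  have h5 : 0 < 1 - tanhSeq ω (n + 1) := by
    rw [one_sub_tanhSeq]
    positivity
  have h6 : (1 + tanhSeq ω (n + 1)) * (1 - tanhSeq ω (n + 1)) * coshSeq ω (n + 1) ^ 2 = 1 := by
    have h := Real.cosh_sq (ω * (n + 1 : ℤ))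
    rw [sinh_eq_tanhSeq_mul, ← coshSeq] at h
    linear_combination h
  rw [current, mul_left_comm, soliton_a_mul_succ, tailSq_solitonVec hω]
  rw [show solitonVec ω n * (-(coshSeq ω n / coshSeq ω (n + 1)) * solitonVec ω n) =
    -(coshSeq ω n / coshSeq ω (n + 1)) * solitonVec ω n ^ 2 by ring, solitonVec_sq]
  field_simp
  linear_combination h6

/-- The tail is proportional to `exp (-ω(n+1)) / cosh (ω(n+1))`. In its double ratio the
exponentials cancel and the `cosh` quotient is the inverse of `a n ^ 2`; the current increment
likewise cancels `b n`. -/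
theorem cost_removeEigenvalue_soliton (n : ℤ) :
    ((soliton hω).removeEigenvalue (neg_two_cosh_notMem hω)
      (soliton_isRealEigenvector hω)).cost n = 0 := by
  have hs := (Real.sinh_pos_iff.2 hω)
  have ha : ((soliton hω).removeEigenvalue (neg_two_cosh_notMem hω)
      (soliton_isRealEigenvector hω)).a n ^ 2 = 1 := by
    rw [removeEigenvalue_a_sq]
    simp only [tailSq_solitonVec hω, one_sub_tanhSeq, soliton, sub_add_cancel, add_assoc,
      one_add_one_eq_two]
    have h0 := coshSeq_pos ω n
    have h1 := coshSeq_pos ω (n + 1)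
    have h2 := coshSeq_pos ω (n + 2)
    have he : Real.exp (-(ω * n)) * Real.exp (-(ω * (n + 2 : ℤ))) =
        Real.exp (-(ω * (n + 1 : ℤ))) ^ 2 := by
      rw [← Real.exp_add, sq, ← Real.exp_add]
      congr 1
      push_cast
      ring
    have hpos := Real.exp_pos (-(ω * (n + 1 : ℤ)))
    rw [neg_sq, div_pow, Real.sq_sqrt (by positivity)]
    field_simp
    linear_combination he
  have hb : ((soliton hω).removeEigenvalue (neg_two_cosh_notMem hω)
      (soliton_isRealEigenvector hω)).b n = 0 := by
    simp only [removeEigenvalue, current_soliton, sub_add_cancel]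
    simp only [soliton, soliton_b_eq]
    ring
  rw [cost, ha, hb, Real.log_one]
  norm_num

theorem hasSum_cost_soliton : HasSum (soliton hω).cost (eigenTerm (-2 * Real.cosh ω)) := by
  have h : HasSum ((soliton hω).removeEigenvalue (neg_two_cosh_notMem hω)
      (soliton_isRealEigenvector hω)).cost 0 := by
    rw [funext (cost_removeEigenvalue_soliton hω)]
    exact hasSum_zero
  simpa using hasSum_cost_of_removeEigenvalue _ _ h

/-- The total cost is one `eigenTerm`, leaving no room for a second eigenvalue with its strictly
positive term. -/
theorem outerEigenvalues_soliton :
    (soliton hω).outerEigenvalues = {-2 * Real.cosh ω} := by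
  have hmem := neg_two_cosh_notMem hω
  have hvec := soliton_isRealEigenvector hω
  ext mu
  rw [Set.mem_singleton_iff]
  constructor
  · intro hmu
    by_contra hne
    have hmu' := (mem_outerEigenvalues_iff _ _).1 hmu
    have := sum_eigenTerm_le {mu, -2 * Real.cosh ω} (soliton hω) (hasSum_cost_soliton hω) (by
      intro lam hlam
      rw [Finset.mem_insert, Finset.mem_singleton] at hlam
      rcases hlam with rfl | rfl
      · exact hmu'
      · exact ⟨hmem, _, hvec⟩)
    rw [Finset.sum_pair hne] at this
    linarith [eigenTerm_pos hmu'.1]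
  · rintro rfl
    exact (mem_outerEigenvalues_iff _ _).2 ⟨hmem, _, hvec⟩

/-! ### Reflectionlessness -/

theorem solitonVec_mul_coshSeq (n : ℤ) :
    solitonVec ω n * coshSeq ω n = √(coshSeq ω n / coshSeq ω (n + 1)) ∧
      solitonVec ω n * coshSeq ω (n + 1) = (√(coshSeq ω n / coshSeq ω (n + 1)))⁻¹ := by
  have h0 := Real.sqrt_pos.2 (coshSeq_pos ω n)
  have h1 := Real.sqrt_pos.2 (coshSeq_pos ω (n + 1))
  have h3 := Real.sq_sqrt (coshSeq_pos ω n).le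
  have h4 := Real.sq_sqrt (coshSeq_pos ω (n + 1)).le
  rw [solitonVec, Real.sqrt_div (coshSeq_pos ω n).le]
  constructor
  · field_simp
    linear_combination -h3
  · field_simp
    linear_combination -h4

/-- The (unnormalized) Jost solution of the one-soliton operator. -/
noncomputable def solitonJost (ω : ℝ) (z : ℂ) (n : ℤ) : ℂ :=
  (solitonVec ω n : ℂ) * ((coshSeq ω (n + 1) : ℂ) * z ^ n - (coshSeq ω n : ℂ) * z ^ (n + 1))

/-- `solitonJost` is the Casoratian of the free solutions `zⁿ` and `cosh (ω n)`, weighted by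
`solitonVec`; the recursion for `cosh` reduces the claim to algebra. -/
theorem diffExpr_solitonJost {z : ℂ} (hz : z ≠ 0) (n : ℤ) :
    (soliton hω).diffExpr (solitonJost ω z) n = -(z + z⁻¹) * solitonJost ω z n := by
  have e1 : ((soliton hω).a n : ℂ) * (solitonVec ω (n + 1) : ℂ) =
      -((coshSeq ω n : ℂ) / coshSeq ω (n + 1)) * solitonVec ω n := by
    exact_mod_cast soliton_a_mul_succ hω n
  have e2 : ((soliton hω).a (n - 1) : ℂ) * (solitonVec ω (n - 1) : ℂ) =
      -((coshSeq ω (n + 1) : ℂ) / coshSeq ω n) * solitonVec ω n := by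
    exact_mod_cast soliton_a_mul_pred hω n
  have h1 : (coshSeq ω (n + 1) : ℂ) + coshSeq ω (n - 1) = 2 * (Real.cosh ω : ℂ) * coshSeq ω n := by
    exact_mod_cast coshSeq_add_coshSeq (ω := ω) n
  have h2 : (coshSeq ω (n + 2) : ℂ) + coshSeq ω n =
      2 * (Real.cosh ω : ℂ) * coshSeq ω (n + 1) := by
    have := coshSeq_add_coshSeq (ω := ω) (n + 1)
    rw [add_sub_cancel_right, add_assoc, one_add_one_eq_two] at this
    exact_mod_cast this
  have c0 : (coshSeq ω n : ℂ) ≠ 0 := by exact_mod_cast (coshSeq_pos ω n).ne'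
  have c1 : (coshSeq ω (n + 1) : ℂ) ≠ 0 := by exact_mod_cast (coshSeq_pos ω (n + 1)).ne'
  have hb : ((soliton hω).b n : ℂ) = (coshSeq ω n : ℂ) / coshSeq ω (n + 1) -
      (coshSeq ω (n - 1) : ℂ) / coshSeq ω n := by
    simp [soliton]
  have z0 : z ^ (n - 1) = z ^ n / z := by rw [zpow_sub_one₀ hz, div_eq_mul_inv]
  have z1 : z ^ (n + 1) = z ^ n * z := zpow_add_one₀ hz n
  have z2 : z ^ (n + 1 + 1) = z ^ n * z * z := by rw [zpow_add_one₀ hz, z1]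
  simp only [diffExpr, solitonJost, sub_add_cancel]
  rw [← mul_assoc, ← mul_assoc, e1, e2, hb, z2, z1, z0, add_assoc n 1 1, one_add_one_eq_two]
  have h1' : (coshSeq ω (n - 1) : ℂ) =
    2 * (Real.cosh ω : ℂ) * coshSeq ω n - coshSeq ω (n + 1) := by linear_combination h1
  have h2' : (coshSeq ω (n + 2) : ℂ) =
    2 * (Real.cosh ω : ℂ) * coshSeq ω (n + 1) - coshSeq ω n := by linear_combination h2
  rw [h1', h2']
  field_simp
  ring

/-- The solution is `zⁿ` times an amplitude depending on `n` only through the `cosh` ratio, which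
converges at both ends; no `z⁻ⁿ` wave appears. -/
theorem solitonJost_eq {z : ℂ} (hz : z ≠ 0) (n : ℤ) : solitonJost ω z n =
    z ^ n * ((((√(coshSeq ω n / coshSeq ω (n + 1)))⁻¹ : ℝ) : ℂ) -
      ((√(coshSeq ω n / coshSeq ω (n + 1)) : ℝ) : ℂ) * z) := by
  rw [← (solitonVec_mul_coshSeq n).2, ← (solitonVec_mul_coshSeq n).1, solitonJost,
    zpow_add_one₀ hz]
  push_cast
  ring

theorem solitonJost_asymptotic {z : ℂ} (hz : ‖z‖ = 1) {l : Filter ℤ} {r : ℝ} (hr : 0 < r)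
    (hl : Tendsto (fun n => coshSeq ω n / coshSeq ω (n + 1)) l (𝓝 r)) (C : ℂ) :
    Tendsto (fun n => C * solitonJost ω z n -
      C * (((√r)⁻¹ : ℝ) - ((√r : ℝ) : ℂ) * z) * z ^ n) l (𝓝 0) := by
  have hz0 : z ≠ 0 := by
    rintro rfl
    simp at hz
  have h1 : Tendsto (fun n => C * ((((√(coshSeq ω n / coshSeq ω (n + 1)))⁻¹ : ℝ) : ℂ) -
      ((√(coshSeq ω n / coshSeq ω (n + 1)) : ℝ) : ℂ) * z)) l
      (𝓝 (C * (((√r)⁻¹ : ℝ) - ((√r : ℝ) : ℂ) * z))) := by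
    refine Tendsto.const_mul C (Tendsto.sub ?_ (Tendsto.mul_const z ?_))
    · exact (Complex.continuous_ofReal.tendsto _).comp
        (hl.sqrt.inv₀ (Real.sqrt_pos.2 hr).ne')
    · exact (Complex.continuous_ofReal.tendsto _).comp hl.sqrt
  have h2 := tendsto_iff_norm_sub_tendsto_zero.1 h1
  rw [tendsto_zero_iff_norm_tendsto_zero]
  refine h2.congr fun n => ?_
  rw [solitonJost_eq hz0, mul_left_comm, mul_comm _ (z ^ n), ← mul_sub (z ^ n), norm_mul (z ^ n),
    norm_zpow, hz, one_zpow, one_mul]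

theorem soliton_isReflectionless : (soliton hω).IsReflectionless := by
  intro z hz _ _
  have hz0 : z ≠ 0 := by
    rintro rfl
    simp at hz
  set α : ℝ := √(Real.exp ω) with hα
  have hα1 : 1 < α := by
    rw [hα, Real.lt_sqrt zero_le_one]
    simpa using hω
  -- The amplitude at `-∞`, by which the solution is normalized. It is nonzero because `α⁻¹ < 1 < α
  -- = ‖α z‖`.
  set d : ℂ := ((α⁻¹ : ℝ) : ℂ) - (α : ℂ) * z with hd
  have hd0 : d ≠ 0 := by
    intro h
    have h1 : ((α⁻¹ : ℝ) : ℂ) = (α : ℂ) * z := sub_eq_zero.1 h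
    have h2 := congrArg norm h1
    rw [norm_mul, hz, mul_one, Complex.norm_real, Complex.norm_real, Real.norm_eq_abs,
      Real.norm_eq_abs, abs_of_pos (by positivity), abs_of_pos (by positivity)] at h2
    have := inv_lt_one_of_one_lt₀ hα1
    linarith
  refine ⟨fun n => d⁻¹ * solitonJost ω z n,
    d⁻¹ * (((√(Real.exp ω)⁻¹)⁻¹ : ℝ) - ((√(Real.exp ω)⁻¹ : ℝ) : ℂ) * z), fun n => ?_, ?_, ?_⟩
  · have := diffExpr_solitonJost hω hz0 n
    simp only [diffExpr] at this ⊢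
    linear_combination d⁻¹ * this
  · have := solitonJost_asymptotic hz (Real.exp_pos ω) (coshSeq_ratio_tendsto_atBot hω) d⁻¹
    rw [← hα, ← hd, inv_mul_cancel₀ hd0] at this
    simpa using this
  · exact solitonJost_asymptotic hz (inv_pos.2 (Real.exp_pos ω))
      (coshSeq_ratio_tendsto_atTop hω) d⁻¹

end soliton

end JacobiCoeffs

theorem mainTheorem1 :
    -- the inequality (the sum over the eigenvalues outside `[-2, 2]` converges and is bounded)
    (∀ J : JacobiCoeffs,
      Summable (fun n : ℤ => J.b n ^ 2) →
      Summable (fun n : ℤ => J.a n ^ 2 - 1 - Real.log (J.a n ^ 2)) →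
      Summable (fun lam : J.outerEigenvalues => eigenTerm lam) ∧
      (∑' lam : J.outerEigenvalues, eigenTerm lam) ≤
        (∑' n : ℤ, J.b n ^ 2) + 2 * ∑' n : ℤ, (J.a n ^ 2 - 1 - Real.log (J.a n ^ 2))) ∧
    -- the special case of discrete Schrödinger operators
    (∀ J : JacobiCoeffs,
      (∀ n, J.a n = -1) →
      Summable (fun n : ℤ => J.b n ^ 2) →
      Summable (fun lam : J.outerEigenvalues => eigenTerm lam) ∧
      (∑' lam : J.outerEigenvalues, eigenTerm lam) ≤ ∑' n : ℤ, J.b n ^ 2) ∧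
    -- sharpness: equality for an explicit family of reflectionless operators
    (∀ ω : ℝ, 0 < ω → ∃ J : JacobiCoeffs,
      (∀ n : ℤ, J.a n =
        -(√(Real.cosh (ω * n) * Real.cosh (ω * (n + 2))) / Real.cosh (ω * (n + 1)))) ∧
      (∀ n : ℤ, J.b n = Real.cosh (ω * n) / Real.cosh (ω * (n + 1)) -
        Real.cosh (ω * (n - 1)) / Real.cosh (ω * n)) ∧
      J.IsReflectionless ∧
      J.outerEigenvalues = {-2 * Real.cosh ω} ∧
      Summable (fun n : ℤ => J.b n ^ 2) ∧
      Summable (fun n : ℤ => J.a n ^ 2 - 1 - Real.log (J.a n ^ 2)) ∧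
      (∑' lam : J.outerEigenvalues, eigenTerm lam) =
        (∑' n : ℤ, J.b n ^ 2) + 2 * ∑' n : ℤ, (J.a n ^ 2 - 1 - Real.log (J.a n ^ 2))) := by
  refine ⟨fun J hb ha => J.eigenTerm_summable_and_tsum_le (JacobiCoeffs.hasSum_cost hb ha),
    fun J ha hb => ?_, fun ω hω => ?_⟩
  · have h := JacobiCoeffs.hasSum_cost hb (J := J) (by simp [ha, summable_zero])
    simp only [ha, even_two, Even.neg_pow, one_pow, sub_self, Real.log_one, tsum_zero, mul_zero,
      add_zero] at h
    exact J.eigenTerm_summable_and_tsum_le h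
  · have hsum := JacobiCoeffs.hasSum_cost_soliton hω
    obtain ⟨hb, ha⟩ := JacobiCoeffs.summable_of_summable_cost hsum.summable
    refine ⟨JacobiCoeffs.soliton hω, fun n => ?_, fun n => ?_,
      JacobiCoeffs.soliton_isReflectionless hω, JacobiCoeffs.outerEigenvalues_soliton hω,
      hb, ha, ?_⟩
    · simp [JacobiCoeffs.soliton, coshSeq]
    · simp [JacobiCoeffs.soliton, coshSeq]
    -- Both sides equal the total cost of the soliton, which is the `eigenTerm` of its only outer
    -- eigenvalue.
    · rw [← hsum.unique (JacobiCoeffs.hasSum_cost hb ha),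
        JacobiCoeffs.outerEigenvalues_soliton hω, tsum_singleton (-2 * Real.cosh ω) eigenTerm]
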